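/- Let $h_*,s_*\ge 0$, $p=h_*+2s_*$, and write $z=(z',z'')\in\mathbb C^{p}\times\mathbb C^p$. The indices $h$ run over the $h_*$ hyperbolic coordinates, and $s$, $s+s_*$ over the $s_*$ pairs of coordinates of complex type. Let $\gamma_h\in(1/2,\infty)$, let $\gamma_s\in\mathbb C$ with $\operatorname{Re}\gamma_s<1/2$, $\operatorname{Im}\gamma_s>0$, and put $\gamma_{s+s_*}=1-\overline{\gamma_s}$. Let $M\subset\mathbb C^{2p}$ be the real analytic submanifold $$z_{p+j}=\big(L_j(z',\bar z')+E_j(z',\bar z')\big)^2,\quad 1\le j\le p,$$ $$L_h=z_h+2\gamma_h\bar z_h,\quad L_s=z_s+2\gamma_s\bar z_{s+s_*},\quad L_{s+s_*}=z_{s+s_*}+2\gamma_{s+s_*}\bar z_s,$$ where the $E_j$ are convergent power series in $(z',\bar z')$ without terms of order less than $2$ (no elliptic components). Let $\mathcal M$ be the complexification $z''=F(z',w')$, $w''=\bar F(w',z')$ of $M: z''=F(z',\bar z')$, with coordinates $(z',w')$, and let $\rho(z',w')=(\overline{w'},\overline{z'})$. There is a unique formal deck transformation $\tau_1$ of $\pi_1:(z',w')\mapsto(z',F(z',w'))$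 whose set of formal fixed points is a formal submanifold of dimension $p$. Put $\tau_2=\rho\tau_1\rho$ and $\sigma=\tau_1\tau_2$. Put $\mu_h=\lambda_h^2$, where $\lambda_h+\bar\lambda_h=\gamma_h^{-1}$, $|\lambda_h|=1$, $0<\arg\lambda_h<\pi/2$; $\mu_s=\bar\gamma_s^{-1}-1$; $\mu_{s+s_*}=\bar\mu_s^{-1}$. Assume that $\mu_1,\dots,\mu_p,\mu_1^{-1},\dots,\mu_p^{-1}$ are distinct, and let $(\xi,\eta)$ be linear coordinates on the $(z',w')$-space in which $D\sigma(0)$ is the diagonal map $(\xi_j,\eta_j)\mapsto(\mu_j\xi_j,\mu_j^{-1}\eta_j)$. Let $\epsilon_h,\epsilon_s\in\{1,-1\}$, $\epsilon_{s+s_*}=\epsilon_s$, and $\nu_j=\mu_j^{\epsilon_j}$ for $1\le j\le p$. Assume that $$\nu^Q\ne\nu_j^{-1}\qquad\text{for all } Q\in\mathbb N^p,\ |Q|>1,\ 1\le j\le p.$$ A pair of asymptotic formal submanifolds of $M$ is a pair $K_1,K_2$ of formal totally real submanifolds of dimension $p$ which are contained in $M$ and in some formal complex submanifold $K$ of dimension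 $p$, and which are transversal at the origin (in $K$). Then $M$ admits a unique pair $K_1^\epsilon,K_2^\epsilon$ of asymptotic formal submanifolds such that the complexification of $K_1^\epsilon$ in $\mathcal M$ is a formal submanifold $\mathcal H_\epsilon$ (of dimension $p$), invariant under $\sigma$, whose tangent space at the origin is $$\bigcap_{\epsilon_j=1}\{\eta_j=0\}\cap\bigcap_{\epsilon_j=-1}\{\xi_j=0\}.$$ The pair is already unique among the pairs of asymptotic formal submanifolds for which the complexification of the first member has this tangent space. Furthermore, the complexification of $K_2^\epsilon$ equals $\tau_1\mathcal H_\epsilon$. -/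

import Mathlib

noncomputable section

namespace CRSing

open MvPowerSeries

/-! ### Formal power series, formal submanifolds -/

/-- Composition `f ∘ a` of formal power series. -/
abbrev comp {α β : Type} (a : α → MvPowerSeries β ℂ) (f : MvPowerSeries α ℂ) :
    MvPowerSeries β ℂ :=
  MvPowerSeries.subst a f

/-- The differential at the origin of a formal power series. -/
def linearPart {β : Type} (f : MvPowerSeries β ℂ) : β → ℂ :=
  fun k => coeff (Finsupp.single k 1) f

/-- A formal power series with positive radius of convergence. -/
def IsConvergent {β : Type} (f : MvPowerSeries β ℂ) : Prop :=
  ∃ C r : ℝ, 0 < r ∧ ∀ n : β →₀ ℕ, ‖coeff n f‖ ≤ C * r ^ n.degree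

/-- `I` is the ideal of a formal complex submanifold through `0` of dimension `d` of the space with
coordinates indexed by `β`: it is generated by `|β| - d` series which vanish at `0` and have
independent differentials at `0`. -/
def IsFormalSubmanifold {β : Type} [Fintype β] (I : Ideal (MvPowerSeries β ℂ)) (d : ℕ) : Prop :=
  ∃ (k : ℕ) (r : Fin k → MvPowerSeries β ℂ), k + d = Fintype.card β ∧
    (∀ i, constantCoeff (r i) = 0) ∧ LinearIndependent ℂ (fun i => linearPart (r i)) ∧
    I = Ideal.span (Set.range r)

/-- The tangent space at `0` defined by an ideal. -/
def tangentSpace {β : Type} [Fintype β] (I : Ideal (MvPowerSeries β ℂ)) :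
    Submodule ℂ (β → ℂ) where
  carrier := {v | ∀ f ∈ I, ∑ k, linearPart f k * v k = 0}
  zero_mem' := by intro f _; simp
  add_mem' := by
    intro a b ha hb f hf
    simp only [Pi.add_apply, mul_add, Finset.sum_add_distrib, ha f hf, hb f hf, add_zero]
  smul_mem' := by
    intro c a ha f hf
    have h := ha f hf
    simp only [Pi.smul_apply, smul_eq_mul, mul_left_comm _ c, ← Finset.mul_sum, h, mul_zero]

/-! Real objects in the complex space with coordinates `z = (z_a)`, `a : α`, are written in the
variables `z` (left summand) and `z̄` (right summand). -/

/-- The complex conjugate of a series `f(z, z̄)`; equivalently, after `z̄` is replaced by an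
independent variable `w`, the series `(z, w) ↦ conj (f (w̄, z̄))`. -/
def conjugate {α : Type} (f : MvPowerSeries (α ⊕ α) ℂ) : MvPowerSeries (α ⊕ α) ℂ :=
  fun n => starRingEnd ℂ (coeff (n.mapDomain Sum.swap) f)

/-- `I` is the ideal, in `ℂ⟦z, z̄⟧`, of a formal real submanifold through `0` of real dimension `d`:
it is generated by `2|α| - d` real-valued series which vanish at `0` and have independent
differentials at `0`. -/
def IsRealFormalSubmanifold {α : Type} [Fintype α] (I : Ideal (MvPowerSeries (α ⊕ α) ℂ))
    (d : ℕ) : Prop :=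
  ∃ (k : ℕ) (r : Fin k → MvPowerSeries (α ⊕ α) ℂ), k + d = Fintype.card (α ⊕ α) ∧
    (∀ i, conjugate (r i) = r i) ∧
    (∀ i, constantCoeff (r i) = 0) ∧ LinearIndependent ℂ (fun i => linearPart (r i)) ∧
    I = Ideal.span (Set.range r)

/-- The real tangent space at `0` (a set of vectors of the complex space) of a formal real
submanifold. -/
def realTangentSpace {α : Type} [Fintype α] (I : Ideal (MvPowerSeries (α ⊕ α) ℂ)) :
    Set (α → ℂ) :=
  {v | Sum.elim v (fun a => starRingEnd ℂ (v a)) ∈ tangentSpace I}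

/-- Totally real at `0`: the tangent space `T` satisfies `T ∩ iT = 0`. -/
def IsTotallyReal {α : Type} [Fintype α] (I : Ideal (MvPowerSeries (α ⊕ α) ℂ)) : Prop :=
  ∀ v ∈ realTangentSpace I, Complex.I • v ∈ realTangentSpace I → v = 0

/-- The ideal in `ℂ⟦z, z̄⟧` generated by a set of holomorphic series, i.e. series in `z`. -/
def holToReal {α : Type} (J : Ideal (MvPowerSeries α ℂ)) : Ideal (MvPowerSeries (α ⊕ α) ℂ) :=
  Ideal.span (comp (fun a => X (Sum.inl a)) '' (J : Set (MvPowerSeries α ℂ)))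

/-! ### Real submanifolds `z'' = F(z', z̄')`

Here `z' = (z_j)`, `z'' = (z_{p+j})` with `j : ι`, `p = |ι|`; the coordinates `(z', z'')` of the
ambient space are indexed by `ι ⊕ ι`, and `F j` is a series in `(z', w')`, where `w' = z̄'`. -/

/-- The ideal in `ℂ⟦z, z̄⟧` of `M : z'' = F(z', z̄')`, generated by the defining equations and their
conjugates. -/
def idealM {ι : Type} (F : ι → MvPowerSeries (ι ⊕ ι) ℂ) :
    Ideal (MvPowerSeries ((ι ⊕ ι) ⊕ (ι ⊕ ι)) ℂ) :=
  let e : ι ⊕ ι → MvPowerSeries ((ι ⊕ ι) ⊕ (ι ⊕ ι)) ℂ :=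
    Sum.elim (fun j => X (Sum.inl (Sum.inl j))) (fun j => X (Sum.inr (Sum.inl j)))
  Ideal.span (Set.range (fun j => X (Sum.inl (Sum.inr j)) - comp e (F j)) ∪
    Set.range (fun j => X (Sum.inr (Sum.inr j)) - comp e (conjugate (F j))))

/-- `K₁, K₂` is a pair of asymptotic formal submanifolds of `M`: formal totally real submanifolds of
dimension `p` contained in `M` and in a formal complex submanifold `K` of dimension `p`, and
transversal at the origin (inside `K`, whose tangent space has real dimension `p + p`). -/
def IsAsymptoticPair {ι : Type} [Fintype ι] (F : ι → MvPowerSeries (ι ⊕ ι) ℂ)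
    (K₁ K₂ : Ideal (MvPowerSeries ((ι ⊕ ι) ⊕ (ι ⊕ ι)) ℂ)) : Prop :=
  IsRealFormalSubmanifold K₁ (Fintype.card ι) ∧ IsRealFormalSubmanifold K₂ (Fintype.card ι) ∧
  IsTotallyReal K₁ ∧ IsTotallyReal K₂ ∧
  idealM F ≤ K₁ ∧ idealM F ≤ K₂ ∧
  realTangentSpace K₁ ∩ realTangentSpace K₂ = {0} ∧
  ∃ K : Ideal (MvPowerSeries (ι ⊕ ι) ℂ), IsFormalSubmanifold K (Fintype.card ι) ∧
    holToReal K ≤ K₁ ∧ holToReal K ≤ K₂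

/-- The complexification in `𝓜` of a formal real submanifold contained in `M`. The complexification
`𝓜 : z'' = F(z', w'), w'' = F̄(w', z')` has the coordinates `(z', w')`. -/
def complexification {ι : Type} (F : ι → MvPowerSeries (ι ⊕ ι) ℂ)
    (I : Ideal (MvPowerSeries ((ι ⊕ ι) ⊕ (ι ⊕ ι)) ℂ)) : Ideal (MvPowerSeries (ι ⊕ ι) ℂ) :=
  let e : (ι ⊕ ι) ⊕ (ι ⊕ ι) → MvPowerSeries (ι ⊕ ι) ℂ :=
    Sum.elim (Sum.elim (fun j => X (Sum.inl j)) F)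
      (Sum.elim (fun j => X (Sum.inr j)) (fun j => conjugate (F j)))
  Ideal.span (comp e '' (I : Set (MvPowerSeries ((ι ⊕ ι) ⊕ (ι ⊕ ι)) ℂ)))

/-! ### Deck transformations -/

/-- The Jacobian matrix at the origin of a formal map. -/
def jacobian {β : Type} (τ : β → MvPowerSeries β ℂ) : Matrix β β ℂ :=
  Matrix.of fun i k => linearPart (τ i) k

/-- Formal deck transformations of `π₁ : 𝓜 → ℂ^{2p}`, `(z', w') ↦ (z', F(z', w'))`. -/
def IsDeckTransformation {ι : Type} [Fintype ι] [DecidableEq ι]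
    (F : ι → MvPowerSeries (ι ⊕ ι) ℂ) (τ : ι ⊕ ι → MvPowerSeries (ι ⊕ ι) ℂ) : Prop :=
  (∀ k, constantCoeff (τ k) = 0) ∧ IsUnit (jacobian τ).det ∧
  (∀ j, τ (Sum.inl j) = X (Sum.inl j)) ∧ (∀ j, comp τ (F j) = F j)

/-- `τ` is a formal deck transformation of `π₁` whose fixed-point set is a formal submanifold of
dimension `p`. -/
def IsTauOne {ι : Type} [Fintype ι] [DecidableEq ι]
    (F : ι → MvPowerSeries (ι ⊕ ι) ℂ) (τ : ι ⊕ ι → MvPowerSeries (ι ⊕ ι) ℂ) : Prop :=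
  IsDeckTransformation F τ ∧
  IsFormalSubmanifold (Ideal.span (Set.range fun k => τ k - X k)) (Fintype.card ι)

/-- `ρ τ ρ`, where `ρ (z', w') = (w̄', z̄')`. -/
def rhoConj {ι : Type} (τ : ι ⊕ ι → MvPowerSeries (ι ⊕ ι) ℂ) :
    ι ⊕ ι → MvPowerSeries (ι ⊕ ι) ℂ :=
  fun k => conjugate (τ k.swap)

/-- `σ = τ₁ τ₂`, where `τ₂ = ρ τ₁ ρ`. -/
def sigma {ι : Type} (τ₁ : ι ⊕ ι → MvPowerSeries (ι ⊕ ι) ℂ) :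
    ι ⊕ ι → MvPowerSeries (ι ⊕ ι) ℂ :=
  fun k => comp (rhoConj τ₁) (τ₁ k)

/-- For a formal biholomorphic map `φ`, the ideal `I'` defines the image under `φ` of the
formal submanifold defined by `I`. -/
def IsImage {β : Type} (φ : β → MvPowerSeries β ℂ) (I I' : Ideal (MvPowerSeries β ℂ)) : Prop :=
  ∀ f, f ∈ I' ↔ comp φ f ∈ I

/-! ### Perturbations of product quadrics without elliptic components

There are `h` hyperbolic coordinates `z_h`, followed by `s` pairs of coordinates `z_s`, `z_{s+s_*}`
of complex type; `p = h + 2s`. -/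

/-- The index set of `z'`. -/
abbrev Idx (h s : ℕ) : Type := Fin h ⊕ (Fin s ⊕ Fin s)

/-- The involution of the indices which exchanges `s` and `s + s_*`. -/
def partner {h s : ℕ} : Idx h s → Idx h s :=
  Sum.map id Sum.swap

/-- The numbers `γ_h`, `γ_s`, `γ_{s+s_*} = 1 - conj γ_s`. -/
def gam {h s : ℕ} (γh : Fin h → ℝ) (γs : Fin s → ℂ) : Idx h s → ℂ :=
  Sum.elim (fun j => (γh j : ℂ)) (Sum.elim γs (fun j => 1 - starRingEnd ℂ (γs j)))

/-- The root `λ` of `λ + conj λ = γ⁻¹`, `|λ| = 1`, with `arg λ ∈ (0, π/2)`, for `γ > 1/2`. -/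
def hypLambda (γ : ℝ) : ℂ := ⟨1 / (2 * γ), Real.sqrt (1 - (1 / (2 * γ)) ^ 2)⟩

/-- The eigenvalues `μ_h = λ_h²`, `μ_s = (conj γ_s)⁻¹ - 1`, `μ_{s+s_*} = (conj μ_s)⁻¹`. -/
def mu {h s : ℕ} (γh : Fin h → ℝ) (γs : Fin s → ℂ) : Idx h s → ℂ :=
  Sum.elim (fun j => hypLambda (γh j) ^ 2)
    (Sum.elim (fun j => (starRingEnd ℂ (γs j))⁻¹ - 1)
      (fun j => (starRingEnd ℂ ((starRingEnd ℂ (γs j))⁻¹ - 1))⁻¹))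

/-- The signs `ε_h`, `ε_s`, `ε_{s+s_*} = ε_s`. -/
def signs {h s : ℕ} (ε : Fin h ⊕ Fin s → ℤˣ) : Idx h s → ℤˣ :=
  Sum.elim (fun j => ε (Sum.inl j))
    (Sum.elim (fun j => ε (Sum.inr j)) (fun j => ε (Sum.inr j)))

/-- `ν_j = μ_j ^ ε_j`. -/
def nu {h s : ℕ} (γh : Fin h → ℝ) (γs : Fin s → ℂ) (ε : Fin h ⊕ Fin s → ℤˣ) : Idx h s → ℂ :=
  fun j => mu γh γs j ^ ((signs ε j : ℤˣ) : ℤ)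

/-- The defining series `(L_j + E_j)²`, where `L_h = z_h + 2 γ_h w_h`,
`L_s = z_s + 2 γ_s w_{s+s_*}` and `L_{s+s_*} = z_{s+s_*} + 2 γ_{s+s_*} w_s`. -/
def definingSeries {h s : ℕ} (γh : Fin h → ℝ) (γs : Fin s → ℂ)
    (E : Idx h s → MvPowerSeries (Idx h s ⊕ Idx h s) ℂ) :
    Idx h s → MvPowerSeries (Idx h s ⊕ Idx h s) ℂ :=
  fun j => (X (Sum.inl j) + (2 * gam γh γs j) • X (Sum.inr (partner j)) + E j) ^ 2

/-- `T v = (ξ, η)` are linear coordinates in which the linear map `S` is the diagonal map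
`(ξ, η) ↦ (μ_j ξ_j, μ_j⁻¹ η_j)`. -/
def IsDiagonalIn {ι : Type} [Fintype ι] (S : Matrix (ι ⊕ ι) (ι ⊕ ι) ℂ) (μ : ι → ℂ)
    (T : (ι ⊕ ι → ℂ) ≃ₗ[ℂ] (ι ⊕ ι → ℂ)) : Prop :=
  ∀ v j, T (S.mulVec v) (Sum.inl j) = μ j * T v (Sum.inl j) ∧
    T (S.mulVec v) (Sum.inr j) = (μ j)⁻¹ * T v (Sum.inr j)

/-- In the linear coordinates `(ξ, η) = T v`, the space
`⋂_{ε_j = 1} {η_j = 0} ∩ ⋂_{ε_j = -1} {ξ_j = 0}`. -/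
def prescribedSpace {ι : Type} (T : (ι ⊕ ι → ℂ) ≃ₗ[ℂ] (ι ⊕ ι → ℂ)) (ε : ι → ℤˣ) :
    Set (ι ⊕ ι → ℂ) :=
  {v | ∀ j, (ε j = 1 → T v (Sum.inr j) = 0) ∧ (ε j = -1 → T v (Sum.inl j) = 0)}

end CRSing

end

/-! Write `F_j = q_j²` with `q_j = L_j + E_j`. Since all `γ_j ≠ 0`, the functions `(z', q)` are
formal coordinates on the complexification (`isTransverse_definingRoot`). A deck transformation
fixes `z'` and each `q_j²`; formal power series over `ℂ` form a domain, so it sends `q_j` to `±q_j`,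
and a `p`-dimensional fixed-point set forces every sign to be minus. Thus `τ₁` is the reflection `q
↦ -q` (`IsTauOne.isReflection`).

A totally real submanifold of dimension `p` in `M` is a graph over the `z'`-space, and its
complexification is `ρ`-invariant. If two of them lie in one complex `K`, then `K` is a graph over
`z'` as well, so `F` has the same restriction to both complexifications and the restrictions of
`q_j` agree up to sign. Transversality forces the sign `-`, so the second complexification is `τ₁`
of the first. As both are `ρ`-invariant and `σ = τ₁ρτ₁ρ`, the first is `σ`-invariant
(`IsAsymptoticPair.exists_param`). Conversely, a formal submanifold `H` invariant under `ρ` and `σ`,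
and transversal to `τ₁H`, yields a pair; `K` is then the image of `H` under `π₁`
(`isAsymptoticPair`).

It remains to find the `σ`-invariant submanifolds with the given tangent space, that is, the sum of
the `ν_j`-eigenspaces of `Dσ`. As a graph `y = g(x)`, such a submanifold solves a homological
equation with divisors `ν_k⁻¹ - ν^Q`. Non-resonance makes them nonzero, and the resulting operator
raises the order of contact, so there is exactly one solution (`exists_invariant`,
`invariant_unique`). Uniqueness gives `ρ`-invariance: `ρσρ = σ⁻¹`, and `ρ` preserves the tangent
space because `conj(ν_j)⁻¹` is again one of the `ν`'s. Transversality holds because `Dτ₁` carries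
`ν`-eigenvectors to `ν⁻¹`-eigenvectors. Submanifolds are handled through `vanishingIdeal` of a
parametrization. -/

noncomputable section

namespace CRSing

open MvPowerSeries

set_option linter.unusedSectionVars false

variable {α β γ κ : Type}

/-! ### Order of vanishing -/

/-- All coefficients of degree less than `d` are zero. -/
def VanishesTo (d : ℕ) (f : MvPowerSeries α ℂ) : Prop :=
  ∀ n : α →₀ ℕ, n.degree < d → coeff n f = 0

theorem vanishesTo_iff {d : ℕ} {f : MvPowerSeries α ℂ} : VanishesTo d f ↔ (d : ℕ∞) ≤ f.order := by
  refine ⟨fun h => le_order fun n hn => h n (by exact_mod_cast hn), fun h n hn => ?_⟩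
  exact coeff_of_lt_order (lt_of_lt_of_le (by exact_mod_cast hn) h)

theorem VanishesTo.mono {d e : ℕ} {f : MvPowerSeries α ℂ} (h : VanishesTo d f) (hed : e ≤ d) :
    VanishesTo e f := fun n hn => h n (hn.trans_le hed)

theorem VanishesTo.zero (d : ℕ) : VanishesTo d (0 : MvPowerSeries α ℂ) := fun _ _ => by simp

theorem VanishesTo.zero_left (f : MvPowerSeries α ℂ) : VanishesTo 0 f :=
  fun _ hn => absurd hn (Nat.not_lt_zero _)

theorem VanishesTo.add {d : ℕ} {f g : MvPowerSeries α ℂ} (hf : VanishesTo d f)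
    (hg : VanishesTo d g) : VanishesTo d (f + g) := fun n hn => by simp [hf n hn, hg n hn]

theorem VanishesTo.sub {d : ℕ} {f g : MvPowerSeries α ℂ} (hf : VanishesTo d f)
    (hg : VanishesTo d g) : VanishesTo d (f - g) := fun n hn => by simp [hf n hn, hg n hn]

theorem VanishesTo.smul {d : ℕ} {f : MvPowerSeries α ℂ} (hf : VanishesTo d f) (c : ℂ) :
    VanishesTo d (c • f) := fun n hn => by simp [hf n hn]

theorem VanishesTo.mul {d e : ℕ} {f g : MvPowerSeries α ℂ} (hf : VanishesTo d f)
    (hg : VanishesTo e g) : VanishesTo (d + e) (f * g) := by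
  rw [vanishesTo_iff] at *
  push_cast
  exact (add_le_add hf hg).trans le_order_mul

theorem vanishesTo_one_iff {f : MvPowerSeries α ℂ} : VanishesTo 1 f ↔ constantCoeff f = 0 := by
  refine ⟨fun h => by simpa using h 0 (by simp), fun h n hn => ?_⟩
  obtain rfl : n = 0 := (Finsupp.degree_eq_zero_iff n).1 (by omega)
  simpa using h

theorem eq_of_forall_vanishesTo {f g : MvPowerSeries α ℂ} (h : ∀ d, VanishesTo d (f - g)) :
    f = g := by
  ext n
  have := h (n.degree + 1) n (Nat.lt_succ_self _)
  rwa [map_sub, sub_eq_zero] at this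

/-! ### Composition of formal maps -/

/-- A formal map which sends the origin to the origin. -/
abbrev Centered (a : β → MvPowerSeries α ℂ) : Prop := ∀ k, constantCoeff (a k) = 0

theorem Centered.hasSubst [Finite β] {a : β → MvPowerSeries α ℂ} (ha : Centered a) : HasSubst a :=
  hasSubst_of_constantCoeff_zero ha

theorem centered_X : Centered (X : α → MvPowerSeries α ℂ) := fun k => by simp

theorem comp_C {a : β → MvPowerSeries α ℂ} (c : ℂ) : comp a (C c) = C c := subst_C c

theorem vanishesTo_prod {a : β → MvPowerSeries α ℂ} (ha : Centered a) (n : β →₀ ℕ) :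
    VanishesTo n.degree (n.prod fun k i => a k ^ i) := by
  classical
  induction n using Finsupp.induction_linear with
  | zero => exact .zero_left _
  | add m n hm hn =>
    rw [Finsupp.prod_add_index' (by simp) (by intros; rw [pow_add]), map_add]
    exact hm.mul hn
  | single k i =>
    rw [Finsupp.prod_single_index (by simp), Finsupp.degree_single]
    induction i with
    | zero => exact .zero_left _
    | succ i ih => rw [pow_succ]; exact ih.mul (vanishesTo_one_iff.2 (ha k))

/-- Telescoping `a^m a^n - b^m b^n = (a^m - b^m) a^n + b^m (a^n - b^n)`: one factor of order 1 is
replaced by a difference of order `d`, a gain of `d - 1`. -/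
theorem vanishesTo_prod_sub_prod {a b : β → MvPowerSeries α ℂ} {d : ℕ} (hd : 1 ≤ d)
    (ha : Centered a) (hb : Centered b)
    (hab : ∀ k, VanishesTo d (a k - b k)) (n : β →₀ ℕ) :
    VanishesTo (d + n.degree - 1)
      ((n.prod fun k i => a k ^ i) - (n.prod fun k i => b k ^ i)) := by
  classical
  have key : ∀ (m n : β →₀ ℕ), VanishesTo (d + m.degree - 1)
      ((m.prod fun k i => a k ^ i) - (m.prod fun k i => b k ^ i)) → VanishesTo (d + n.degree - 1)
      ((n.prod fun k i => a k ^ i) - (n.prod fun k i => b k ^ i)) →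
      VanishesTo (d + (m + n).degree - 1)
      (((m + n).prod fun k i => a k ^ i) - ((m + n).prod fun k i => b k ^ i)) := by
    intro m n hm hn
    rw [Finsupp.prod_add_index' (by simp) (by intros; rw [pow_add]),
      Finsupp.prod_add_index' (by simp) (by intros; rw [pow_add]), map_add]
    have := ((hm.mul (vanishesTo_prod ha n)).mono
      (show d + (m.degree + n.degree) - 1 ≤ _ by omega)).add
      (((vanishesTo_prod hb m).mul hn).mono (show d + (m.degree + n.degree) - 1 ≤ _ by omega))
    convert this using 1
    ring
  induction n using Finsupp.induction_linear with
  | zero => simpa using VanishesTo.zero _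
  | add m n hm hn => exact key m n hm hn
  | single k i =>
    induction i with
    | zero => simpa using VanishesTo.zero _
    | succ i ih =>
      rw [Finsupp.single_add]
      refine key _ _ ih ?_
      simpa using hab k

section comp

variable [Finite β] {a b : β → MvPowerSeries α ℂ}

theorem comp_add (ha : Centered a) (f g) : comp a (f + g) = comp a f + comp a g :=
  subst_add ha.hasSubst f g

theorem comp_sub (ha : Centered a) (f g) : comp a (f - g) = comp a f - comp a g :=
  subst_sub ha.hasSubst f g

theorem comp_pow (ha : Centered a) (f) (n : ℕ) : comp a (f ^ n) = comp a f ^ n :=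
  subst_pow ha.hasSubst f n

theorem comp_smul (ha : Centered a) (c : ℂ) (f) : comp a (c • f) = c • comp a f :=
  subst_smul ha.hasSubst c f

theorem comp_zero (ha : Centered a) : comp a (0 : MvPowerSeries β ℂ) = 0 := by
  simpa using map_zero (substAlgHom (R := ℂ) ha.hasSubst)

theorem comp_neg (ha : Centered a) (f) : comp a (-f) = -comp a f := by
  simpa using map_neg (substAlgHom (R := ℂ) ha.hasSubst) f

theorem comp_sum (ha : Centered a) {ι : Type*} (s : Finset ι) (f : ι → MvPowerSeries β ℂ) :
    comp a (∑ i ∈ s, f i) = ∑ i ∈ s, comp a (f i) := by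
  have := map_sum (substAlgHom (R := ℂ) ha.hasSubst) f s
  simpa only [coe_substAlgHom] using this

theorem comp_X (ha : Centered a) (k) : comp a (X k) = a k := subst_X ha.hasSubst k

theorem comp_id (f : MvPowerSeries α ℂ) : comp X f = f := by
  rw [comp, subst_self]; rfl

theorem constantCoeff_comp (ha : Centered a) {f : MvPowerSeries β ℂ} (hf : constantCoeff f = 0) :
    constantCoeff (comp a f) = 0 := constantCoeff_subst_eq_zero ha.hasSubst ha hf

theorem comp_comp [Finite α] {c : α → MvPowerSeries γ ℂ} (ha : Centered a) (hc : Centered c)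
    (f : MvPowerSeries β ℂ) : comp c (comp a f) = comp (fun k => comp c (a k)) f :=
  subst_comp_subst_apply ha.hasSubst hc.hasSubst f

theorem Centered.comp {κ : Type*} {c : κ → MvPowerSeries β ℂ} (hc : ∀ k, constantCoeff (c k) = 0)
    (ha : Centered a) : ∀ k, constantCoeff (CRSing.comp a (c k)) = 0 :=
  fun k => constantCoeff_comp ha (hc k)

theorem VanishesTo.comp {m : ℕ} {f : MvPowerSeries β ℂ} (hf : VanishesTo m f) (ha : Centered a) :
    VanishesTo m (CRSing.comp a f) := by
  intro n hn
  rw [coeff_subst ha.hasSubst, finsum_eq_zero_of_forall_eq_zero]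
  intro e
  by_cases he : e.degree < m
  · simp [hf e he]
  · rw [vanishesTo_prod ha e n (by omega), smul_zero]

/-- If `f` vanishes to order `m` and `a`, `b` agree to order `d`, then `f ∘ a`, `f ∘ b` agree to
order `d + m - 1`. -/
theorem VanishesTo.comp_sub_comp {m d e : ℕ} {f : MvPowerSeries β ℂ} (hf : VanishesTo m f)
    (ha : Centered a) (hb : Centered b) (hd : 1 ≤ d) (hab : ∀ k, VanishesTo d (a k - b k))
    (he : e ≤ d + m - 1) : VanishesTo e (CRSing.comp a f - CRSing.comp b f) := by
  intro n hn
  rw [map_sub, coeff_subst ha.hasSubst, coeff_subst hb.hasSubst, sub_eq_zero]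
  refine finsum_congr fun q => ?_
  by_cases hq : q.degree < m
  · simp [hf q hq]
  · have := vanishesTo_prod_sub_prod hd ha hb hab q n (by omega)
    rw [map_sub, sub_eq_zero] at this
    rw [this]

end comp

/-! ### Differentials -/

theorem linearPart_add (f g : MvPowerSeries α ℂ) :
    linearPart (f + g) = linearPart f + linearPart g := by ext; simp [linearPart]

theorem linearPart_sub (f g : MvPowerSeries α ℂ) :
    linearPart (f - g) = linearPart f - linearPart g := by ext; simp [linearPart]

theorem linearPart_neg (f : MvPowerSeries α ℂ) : linearPart (-f) = -linearPart f := by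
  ext; simp [linearPart]

theorem linearPart_smul (c : ℂ) (f : MvPowerSeries α ℂ) :
    linearPart (c • f) = c • linearPart f := by ext; simp [linearPart]

theorem linearPart_zero : linearPart (0 : MvPowerSeries α ℂ) = 0 := by ext; simp [linearPart]

theorem linearPart_sum {ι : Type*} (s : Finset ι) (f : ι → MvPowerSeries α ℂ) :
    linearPart (∑ i ∈ s, f i) = ∑ i ∈ s, linearPart (f i) := by ext; simp [linearPart]

theorem linearPart_X [DecidableEq α] (k : α) :
    linearPart (X k : MvPowerSeries α ℂ) = Pi.single k 1 := by
  classical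
  ext j
  simp only [linearPart, coeff_X, Finsupp.single_left_inj (one_ne_zero), Pi.single_apply]

theorem linearPart_eq_zero {f : MvPowerSeries α ℂ} (hf : VanishesTo 2 f) : linearPart f = 0 := by
  ext k; exact hf _ (by simp)

theorem vanishesTo_two_iff {f : MvPowerSeries α ℂ} :
    VanishesTo 2 f ↔ constantCoeff f = 0 ∧ linearPart f = 0 := by
  refine ⟨fun h => ⟨vanishesTo_one_iff.1 (h.mono one_le_two), linearPart_eq_zero h⟩, fun h n hn => ?_⟩
  obtain hn | hn : n.degree = 0 ∨ n.degree = 1 := by omega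
  · exact vanishesTo_one_iff.2 h.1 n (by omega)
  · obtain ⟨k, hk⟩ : ∃ k, n k ≠ 0 := by
      by_contra! h0
      rw [(Finsupp.degree_eq_zero_iff n).2 (Finsupp.ext h0)] at hn
      exact zero_ne_one hn
    obtain ⟨m, rfl⟩ := exists_add_of_le (Finsupp.single_le_iff.2 (Nat.one_le_iff_ne_zero.2 hk))
    rw [map_add, Finsupp.degree_single] at hn
    rw [(Finsupp.degree_eq_zero_iff m).1 (by omega), add_zero]
    exact congr_fun h.2 k

theorem linearPart_mul (f g : MvPowerSeries α ℂ) :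
    linearPart (f * g) = constantCoeff f • linearPart g + constantCoeff g • linearPart f := by
  have key : VanishesTo 2 ((f - C (constantCoeff f)) * (g - C (constantCoeff g))) :=
    VanishesTo.mul (d := 1) (e := 1) (vanishesTo_one_iff.2 (by simp))
      (vanishesTo_one_iff.2 (by simp))
  have hC : ∀ c : ℂ, linearPart (C c : MvPowerSeries α ℂ) = 0 := fun c => by
    classical
    ext k; simp [linearPart, coeff_C]
  have e : f * g = (f - C (constantCoeff f)) * (g - C (constantCoeff g)) +
      (constantCoeff f • g + constantCoeff g • f) - C (constantCoeff f * constantCoeff g) := by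
    rw [smul_eq_C_mul, smul_eq_C_mul, map_mul]; ring
  rw [e, linearPart_sub, linearPart_add, linearPart_add, linearPart_eq_zero key, hC,
    linearPart_smul, linearPart_smul]
  simp

/-- The chain rule. Without its affine part `f` vanishes to order two, and composition preserves
this order, so only the linear terms contribute. -/
theorem linearPart_comp [Fintype β] {a : β → MvPowerSeries α ℂ} (ha : Centered a)
    (f : MvPowerSeries β ℂ) : linearPart (comp a f) = ∑ b, linearPart f b • linearPart (a b) := by
  classical
  set g := f - C (constantCoeff f) - ∑ b, linearPart f b • X b with hg
  have hC : ∀ {α : Type} (c : ℂ), linearPart (C c : MvPowerSeries α ℂ) = 0 := fun c => by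
    ext k; simp [linearPart, coeff_C]
  have hg2 : VanishesTo 2 g := by
    refine vanishesTo_two_iff.2 ⟨by simp [hg], ?_⟩
    rw [hg, linearPart_sub, linearPart_sub, hC, linearPart_sum]
    ext k
    simp [linearPart_smul, linearPart_X, Finset.sum_apply, Pi.single_apply]
  have e : f = g + C (constantCoeff f) + ∑ b, linearPart f b • X b := by rw [hg]; ring
  conv_lhs => rw [e]
  rw [comp_add ha, comp_add ha, comp_C, comp_sum ha, linearPart_add, linearPart_add, hC,
    linearPart_eq_zero (hg2.comp ha), linearPart_sum]
  simp [comp_smul ha, comp_X ha, linearPart_smul]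

/-- The differential at the origin of a formal map. -/
def diff [Fintype α] (a : β → MvPowerSeries α ℂ) : (α → ℂ) →ₗ[ℂ] (β → ℂ) :=
  Matrix.mulVecLin (Matrix.of fun i k => linearPart (a i) k)

theorem diff_apply [Fintype α] (a : β → MvPowerSeries α ℂ) (v : α → ℂ) (b : β) :
    diff a v b = ∑ k, linearPart (a b) k * v k := rfl

theorem diff_comp [Fintype α] [Fintype β] {a : β → MvPowerSeries α ℂ} (ha : Centered a)
    (c : γ → MvPowerSeries β ℂ) (v : α → ℂ) :
    diff (fun k => comp a (c k)) v = diff c (diff a v) := by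
  ext k
  simp only [diff_apply, linearPart_comp ha, Finset.sum_apply, Pi.smul_apply, smul_eq_mul,
    Finset.sum_mul, Finset.mul_sum]
  rw [Finset.sum_comm]
  simp only [mul_assoc]

theorem diff_X [Fintype α] (v : α → ℂ) : diff X v = v := by
  classical
  ext k; simp [diff_apply, linearPart_X, Pi.single_apply]

/-- The formal map given by a linear map. -/
def ofLinear [Fintype α] [DecidableEq α] (A : (α → ℂ) →ₗ[ℂ] (β → ℂ)) : β → MvPowerSeries α ℂ :=
  fun b => ∑ a, A (Pi.single a 1) b • X a

section ofLinear

variable [Fintype α] [DecidableEq α]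

theorem centered_ofLinear (A : (α → ℂ) →ₗ[ℂ] (β → ℂ)) : Centered (ofLinear A) := fun k => by
  simp [ofLinear]

theorem diff_ofLinear (A : (α → ℂ) →ₗ[ℂ] (β → ℂ)) : diff (ofLinear A) = A := by
  ext a b
  simp [diff_apply, ofLinear, linearPart_sum, linearPart_smul, linearPart_X,
    Pi.single_apply]

theorem comp_ofLinear {a : α → MvPowerSeries γ ℂ} (ha : Centered a)
    (A : (α → ℂ) →ₗ[ℂ] (β → ℂ)) (b : β) :
    comp a (ofLinear A b) = ∑ k, A (Pi.single k 1) b • a k := by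
  simp [ofLinear, comp_sum ha, comp_smul ha, comp_X ha]

theorem comp_ofLinear_ofLinear [Fintype β] [DecidableEq β] (A : (α → ℂ) →ₗ[ℂ] (β → ℂ))
    (B : (β → ℂ) →ₗ[ℂ] (γ → ℂ)) (k : γ) :
    comp (ofLinear A) (ofLinear B k) = ofLinear (B ∘ₗ A) k := by
  rw [comp_ofLinear (centered_ofLinear A)]
  simp only [ofLinear, Finset.smul_sum, smul_smul, LinearMap.comp_apply]
  rw [Finset.sum_comm]
  refine Finset.sum_congr rfl fun a _ => ?_
  rw [← Finset.sum_smul]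
  congr 1
  conv_rhs => rw [← LinearMap.sum_single_apply (fun _ => ℂ) (A (Pi.single a 1))]
  have : ∀ b, (Pi.single b (A (Pi.single a 1) b) : β → ℂ) =
      (A (Pi.single a 1) b) • Pi.single b 1 := fun b => by
    rw [← Pi.single_smul]; simp
  simp [map_sum, Finset.sum_apply, this, mul_comm]

theorem ofLinear_id : ofLinear (LinearMap.id : (α → ℂ) →ₗ[ℂ] (α → ℂ)) = X := by
  ext1 k
  simp [ofLinear, Pi.single_apply]

end ofLinear

/-! ### Formal contractions -/

/-- A self-map of the tuples of series vanishing to order `m` which increases the order of contact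
has a fixed point. -/
theorem exists_fixedPoint (m : ℕ) (Φ : (κ → MvPowerSeries α ℂ) → κ → MvPowerSeries α ℂ)
    (hm : ∀ g, (∀ k, VanishesTo m (g k)) → ∀ k, VanishesTo m (Φ g k))
    (hc : ∀ g g' d, (∀ k, VanishesTo m (g k)) → (∀ k, VanishesTo m (g' k)) →
      (∀ k, VanishesTo d (g k - g' k)) → ∀ k, VanishesTo (d + 1) (Φ g k - Φ g' k)) :
    ∃ g, (∀ k, VanishesTo m (g k)) ∧ Φ g = g := by
  set u : ℕ → κ → MvPowerSeries α ℂ := fun i => Φ^[i] 0 with hu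
  have hu1 : ∀ i, u (i + 1) = Φ (u i) := fun i => by
    simp only [hu, Function.iterate_succ_apply']
  have hum : ∀ i k, VanishesTo m (u i k) := by
    intro i
    induction i with
    | zero => exact fun k => .zero m
    | succ i ih => rw [hu1]; exact hm _ ih
  have hstep : ∀ i k, VanishesTo i (u (i + 1) k - u i k) := by
    intro i
    induction i with
    | zero => exact fun k => .zero_left _
    | succ i ih =>
      intro k
      have := hc (u (i + 1)) (u i) i (hum _) (hum _) ih k
      rwa [← hu1, ← hu1] at this
  have hstab : ∀ i j k, VanishesTo i (u (i + j) k - u i k) := by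
    intro i j k
    induction j with
    | zero => simpa using VanishesTo.zero i
    | succ j ih =>
      have := ((hstep (i + j) k).mono (Nat.le_add_right i j)).add ih
      rwa [sub_add_sub_cancel] at this
  -- From index `i` on, the iterates agree below degree `i`; the coefficient at `n` is therefore
  -- final from index `n.degree + 1`.
  set g : κ → MvPowerSeries α ℂ := fun k n => coeff n (u (n.degree + 1) k) with hg
  have hgu : ∀ i k, VanishesTo i (g k - u i k) := by
    intro i k n hn
    obtain ⟨j, rfl⟩ := Nat.exists_eq_add_of_lt hn
    have := hstab (n.degree + 1) j k n (Nat.lt_succ_self _)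
    rw [map_sub, sub_eq_zero] at this ⊢
    rw [show n.degree + j + 1 = n.degree + 1 + j by ring, this]
    rfl
  have hgm : ∀ k, VanishesTo m (g k) := fun k => by
    have := (hgu m k).add (hum m k)
    rwa [sub_add_cancel] at this
  refine ⟨g, hgm, funext fun k => eq_of_forall_vanishesTo fun d => ?_⟩
  have h1 := hc g (u d) d hgm (hum d) (hgu d) k
  rw [← hu1] at h1
  have := (h1.sub (hgu (d + 1) k)).mono (Nat.le_succ d)
  rwa [sub_sub_sub_cancel_right] at this

/-! ### Formal inverse functions -/

/-- With `φ = id + N`, the equation `φ ∘ ψ = id` is the fixed-point equation `ψ = id - N ∘ ψ`, and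
`N` of order two makes the right side a formal contraction. -/
theorem exists_rightInverse_of_diff_eq_id [Fintype β] {φ : β → MvPowerSeries β ℂ}
    (hφ : Centered φ) (h : diff φ = LinearMap.id) :
    ∃ ψ : β → MvPowerSeries β ℂ, Centered ψ ∧ ∀ k, comp ψ (φ k) = X k := by
  classical
  have hN : ∀ k, VanishesTo 2 (φ k - X k) := fun k => by
    refine vanishesTo_two_iff.2 ⟨by simp [hφ k], ?_⟩
    ext j
    have := congr_fun (LinearMap.congr_fun h (Pi.single j 1)) k
    simp only [diff_apply, Pi.single_apply, mul_ite, mul_one, mul_zero, Finset.sum_ite_eq',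
      Finset.mem_univ, if_true, LinearMap.id_apply] at this
    rw [linearPart_sub, linearPart_X, Pi.sub_apply, this, Pi.single_apply, Pi.zero_apply]
    simp [eq_comm]
  have hc1 : ∀ g : β → MvPowerSeries β ℂ, (∀ k, VanishesTo 1 (g k)) → Centered g :=
    fun g hg k => vanishesTo_one_iff.1 (hg k)
  have hm : ∀ g : β → MvPowerSeries β ℂ, (∀ k, VanishesTo 1 (g k)) →
      ∀ k, VanishesTo 1 (X k - comp g (φ k - X k)) := fun g hg k =>
    (vanishesTo_one_iff.2 (by simp)).sub (((hN k).comp (hc1 g hg)).mono one_le_two)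
  obtain ⟨ψ, hψ1, hψ⟩ := exists_fixedPoint 1 (fun g k => X k - comp g (φ k - X k)) hm (by
    intro g g' d hg hg' hd k
    -- The composition estimate needs `1 ≤ d`; for `d = 0` it is enough that both values vanish to
    -- order 1.
    rcases Nat.eq_zero_or_pos d with rfl | hd0
    · exact (hm g hg k).sub (hm g' hg' k)
    · have := ((hN k).comp_sub_comp (hc1 g' hg') (hc1 g hg) hd0 (fun k => ?_)
        (show d + 1 ≤ d + 2 - 1 by omega))
      · rwa [sub_sub_sub_cancel_left]
      · rw [← neg_sub]
        simpa using (hd k).smul (-1))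
  refine ⟨ψ, hc1 ψ hψ1, fun k => ?_⟩
  have := congr_fun hψ k
  simp only [comp_sub (hc1 ψ hψ1), comp_X (hc1 ψ hψ1)] at this
  linear_combination -this

/-- The right inverse `ψ` again has identity differential, hence its own right inverse, which must
be `φ`. -/
theorem exists_inverse_of_diff_eq_id [Fintype β] {φ : β → MvPowerSeries β ℂ}
    (hφ : Centered φ) (h : diff φ = LinearMap.id) :
    ∃ ψ : β → MvPowerSeries β ℂ, Centered ψ ∧ (∀ k, comp φ (ψ k) = X k) ∧
      ∀ k, comp ψ (φ k) = X k := by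
  obtain ⟨ψ, hψ, h1⟩ := exists_rightInverse_of_diff_eq_id hφ h
  have hdψ : diff ψ = LinearMap.id := by
    refine LinearMap.ext fun v => ?_
    have := LinearMap.congr_fun (congrArg diff (funext h1)) v
    rwa [diff_comp hψ, h, diff_X] at this
  obtain ⟨χ, hχ, h2⟩ := exists_rightInverse_of_diff_eq_id hψ hdψ
  have : χ = φ := by
    funext k
    have := comp_comp hψ hχ (φ k)
    rw [h1, comp_X hχ] at this
    rw [this, show (fun k => comp χ (ψ k)) = X from funext h2, comp_id]
  exact ⟨ψ, hψ, this ▸ h2, h1⟩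

/-- The formal inverse function theorem. -/
theorem exists_inverse [Fintype α] [Fintype β] {φ : α → MvPowerSeries β ℂ}
    (hφ : Centered φ) (h : Function.Bijective (diff φ)) :
    ∃ ψ : β → MvPowerSeries α ℂ, Centered ψ ∧ (∀ k, comp φ (ψ k) = X k) ∧
      ∀ k, comp ψ (φ k) = X k := by
  classical
  set A := LinearEquiv.ofBijective (diff φ) h with hA
  set B : (α → ℂ) →ₗ[ℂ] (β → ℂ) := A.symm.toLinearMap with hB
  have hBA : B ∘ₗ diff φ = LinearMap.id := by
    exact LinearMap.ext fun v => A.symm_apply_apply v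
  have hAB : diff φ ∘ₗ B = LinearMap.id := by
    exact LinearMap.ext fun v => A.apply_symm_apply v
  -- As a map this is `B ∘ φ` with `B` the inverse of the differential, so that its differential is
  -- the identity.
  set φ₁ : β → MvPowerSeries β ℂ := fun k => comp φ (ofLinear B k) with hφ₁
  have hφ₁0 : Centered φ₁ := Centered.comp (centered_ofLinear B) hφ
  have hd : diff φ₁ = LinearMap.id := by
    rw [← hBA]
    refine LinearMap.ext fun v => ?_
    rw [hφ₁, diff_comp hφ, diff_ofLinear]; rfl
  obtain ⟨ψ, hψ, h1, h2⟩ := exists_inverse_of_diff_eq_id hφ₁0 hd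
  refine ⟨fun k => comp (ofLinear B) (ψ k), Centered.comp hψ (centered_ofLinear B), fun k => ?_,
    fun k => ?_⟩
  · rw [comp_comp (centered_ofLinear B) hφ]
    exact h1 k
  · have key : ∀ k, comp ψ (φ k) = ofLinear (diff φ) k := fun k => by
      have e : ∀ k, comp φ₁ (ofLinear (diff φ) k) = φ k := fun k => by
        have := comp_comp (centered_ofLinear B) hφ (ofLinear (diff φ) k)
        rw [comp_ofLinear_ofLinear, hAB, ofLinear_id, comp_X hφ] at this
        exact this.symm
      rw [← e, comp_comp hφ₁0 hψ, funext h2, comp_id]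
    rw [← comp_comp hψ (centered_ofLinear B), key, comp_ofLinear_ofLinear, hAB, ofLinear_id]

/-! ### Parametrized ideals -/

/-- The ideal of the series which vanish on the image of a formal map. -/
def vanishingIdeal [Finite β] (θ : β → MvPowerSeries α ℂ) (hθ : Centered θ) :
    Ideal (MvPowerSeries β ℂ) :=
  RingHom.ker (substAlgHom (R := ℂ) hθ.hasSubst)

theorem mem_vanishingIdeal [Finite β] {θ : β → MvPowerSeries α ℂ} {hθ : Centered θ}
    {f : MvPowerSeries β ℂ} : f ∈ vanishingIdeal θ hθ ↔ comp θ f = 0 := by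
  simp [vanishingIdeal, RingHom.mem_ker]

/-- Every monomial of `g` contains a variable from `s`. The induction is over the finite set `s`,
splitting off all monomials divisible by one variable at a time, since `g` may have infinitely many
monomials. -/
theorem mem_span_X_of_coeff_eq_zero (s : Finset κ) (g : MvPowerSeries κ ℂ)
    (hg : ∀ n : κ →₀ ℕ, (∀ j ∈ s, n j = 0) → coeff n g = 0) :
    g ∈ Ideal.span (X '' (s : Set κ) : Set (MvPowerSeries κ ℂ)) := by
  classical
  induction s using Finset.induction_on generalizing g with
  | empty =>
    have : g = 0 := by ext n; simpa using hg n (by simp)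
    rw [this]; exact Ideal.zero_mem _
  | insert j s hj ih =>
    set g₂ : MvPowerSeries κ ℂ := fun n => if n j = 0 then coeff n g else 0 with hg₂
    have hc : ∀ n, coeff n g₂ = if n j = 0 then coeff n g else 0 := fun n => rfl
    have h2 : g₂ ∈ Ideal.span (X '' (s : Set κ) : Set (MvPowerSeries κ ℂ)) := by
      refine ih g₂ fun n hn => ?_
      rw [hc]
      split_ifs with h
      · exact hg n fun i hi => by
          rcases Finset.mem_insert.1 hi with rfl | hi
          exacts [h, hn i hi]
      · rfl
    have h1 : X j ∣ g - g₂ := X_dvd_iff.2 fun n hn => by simp [hc, hn]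
    rw [← sub_add_cancel g g₂]
    refine Ideal.add_mem _ ?_ (Ideal.span_mono (Set.image_mono (by simp)) h2)
    obtain ⟨q, hq⟩ := h1
    rw [hq]
    exact Ideal.mul_mem_right _ _ (Ideal.subset_span ⟨j, by simp, rfl⟩)

theorem centered_elim_X_zero : Centered (Sum.elim X 0 : α ⊕ κ → MvPowerSeries α ℂ) := by
  rintro (k | k) <;> simp

/-- Let `g₂` be the restriction of `g` to `y = 0`, read again as a series in `(x, y)`. Every
monomial of `g - g₂` contains some `y`, and `g₂` is zero by hypothesis. -/
theorem mem_span_X_inr [Fintype α] [Fintype κ] {g : MvPowerSeries (α ⊕ κ) ℂ}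
    (hg : comp (Sum.elim X 0 : α ⊕ κ → MvPowerSeries α ℂ) g = 0) :
    g ∈ Ideal.span (Set.range fun j : κ => (X (Sum.inr j) : MvPowerSeries (α ⊕ κ) ℂ)) := by
  classical
  set g₁ := killCompl (R := ℂ) (Function.Embedding.inl (α := α) (β := κ)) g with hg₁
  set g₂ := rename (R := ℂ) (Function.Embedding.inl (α := α) (β := κ)) g₁ with hg₂
  have h12 : comp (Sum.elim X 0 : α ⊕ κ → MvPowerSeries α ℂ) g₂ = g₁ := by
    rw [hg₂, rename_eq_subst, comp, subst_comp_subst_apply (HasSubst.X_comp _)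
      (centered_elim_X_zero).hasSubst]
    conv_rhs => rw [← comp_id g₁]
    congr 1
    funext k
    exact comp_X centered_elim_X_zero _
  have hmem : g - g₂ ∈ Ideal.span
      (Set.range fun j : κ => (X (Sum.inr j) : MvPowerSeries (α ⊕ κ) ℂ)) := by
    have := mem_span_X_of_coeff_eq_zero (Finset.univ.image (Sum.inr : κ → α ⊕ κ)) (g - g₂) ?_
    · simpa [← Set.range_comp, Function.comp_def] using this
    · intro n hn
      obtain ⟨x, rfl⟩ : ∃ x, n = Finsupp.embDomain (Function.Embedding.inl (α := α) (β := κ)) x := by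
        refine ⟨n.comapDomain Sum.inl Sum.inl_injective.injOn, ?_⟩
        ext (i | i)
        · exact (Finsupp.embDomain_apply_self (Function.Embedding.inl (α := α) (β := κ))
            (n.comapDomain Sum.inl Sum.inl_injective.injOn) i).symm
        · rw [hn _ (by simp), Finsupp.embDomain_of_notMem_range]
          simp
      rw [map_sub, hg₂, coeff_embDomain_rename, hg₁, coeff_killCompl, sub_self]
  have : g₁ = 0 := by
    rw [← h12]
    have h0 : comp (Sum.elim X 0 : α ⊕ κ → MvPowerSeries α ℂ) (g - g₂) = 0 := by
      rw [← mem_vanishingIdeal (hθ := centered_elim_X_zero)]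
      refine (Ideal.span_le.2 ?_) hmem
      rintro _ ⟨j, rfl⟩
      rw [SetLike.mem_coe, mem_vanishingIdeal, comp_X centered_elim_X_zero]
      rfl
    rw [comp_sub centered_elim_X_zero, hg, zero_sub, neg_eq_zero] at h0
    exact h0
  rw [hg₂, this, map_zero, sub_zero] at hmem
  exact hmem

/-- The formal implicit function theorem: series `r` which form, together with `π`, a formal
coordinate system, generate the ideal of a formal submanifold parametrized by `π`. -/
theorem exists_parametrization [Fintype α] [Fintype β] [Fintype κ] {π : α → MvPowerSeries β ℂ}
    {r : κ → MvPowerSeries β ℂ} (hπ : Centered π) (hr : Centered r)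
    (h : Function.Bijective (diff (Sum.elim π r))) :
    ∃ (θ : β → MvPowerSeries α ℂ) (hθ : Centered θ), (∀ a, comp θ (π a) = X a) ∧
      Ideal.span (Set.range r) = vanishingIdeal θ hθ := by
  have hφ : Centered (Sum.elim π r) := by
    rintro (k | k)
    exacts [hπ k, hr k]
  obtain ⟨ψ, hψ, h1, h2⟩ := exists_inverse hφ h
  -- The parametrization is the inverse of the coordinate map `(π, r)`, restricted to `r = 0`.
  have hθ : Centered fun b => comp (Sum.elim X 0 : α ⊕ κ → MvPowerSeries α ℂ) (ψ b) :=
    Centered.comp hψ centered_elim_X_zero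
  refine ⟨_, hθ, fun a => ?_, le_antisymm ?_ fun f hf => ?_⟩
  · rw [← comp_comp hψ centered_elim_X_zero, show π a = Sum.elim π r (Sum.inl a) from rfl, h2,
      comp_X centered_elim_X_zero]
    rfl
  · refine Ideal.span_le.2 ?_
    rintro _ ⟨j, rfl⟩
    rw [SetLike.mem_coe, mem_vanishingIdeal, ← comp_comp hψ centered_elim_X_zero,
      show r j = Sum.elim π r (Sum.inr j) from rfl, h2, comp_X centered_elim_X_zero]
    rfl
  · rw [mem_vanishingIdeal, ← comp_comp hψ centered_elim_X_zero] at hf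
    have hm := Ideal.mem_map_of_mem (substAlgHom (R := ℂ) hφ.hasSubst) (mem_span_X_inr hf)
    rw [Ideal.map_span, ← Set.range_comp] at hm
    have e : substAlgHom (R := ℂ) hφ.hasSubst (comp ψ f) = f := by
      rw [coe_substAlgHom]
      have := comp_comp hψ hφ f
      rwa [funext h1, comp_id] at this
    rw [e] at hm
    convert hm using 3
    funext j
    simp only [Function.comp_apply, coe_substAlgHom]
    exact (comp_X hφ (Sum.inr j)).symm

/-! ### Immersed parametrizations -/

/-- For a linear left inverse `B` of the differential, `B ∘ θ` has identity differential; `π` is its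
formal inverse applied after `B`. -/
theorem exists_leftInverse [Fintype α] [Fintype β] {θ : β → MvPowerSeries α ℂ} (hθ : Centered θ)
    (h : Function.Injective (diff θ)) :
    ∃ π : α → MvPowerSeries β ℂ, Centered π ∧ ∀ a, comp θ (π a) = X a := by
  classical
  obtain ⟨B, hB⟩ := (diff θ).exists_leftInverse_of_injective (LinearMap.ker_eq_bot.2 h)
  have hφ : Centered fun a => comp θ (ofLinear B a) := Centered.comp (centered_ofLinear B) hθ
  obtain ⟨χ, hχ, h1, -⟩ := exists_inverse_of_diff_eq_id hφ <| LinearMap.ext fun v => by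
    rw [diff_comp hθ, diff_ofLinear]
    exact LinearMap.congr_fun hB v
  refine ⟨fun a => comp (ofLinear B) (χ a), Centered.comp hχ (centered_ofLinear B), fun a => ?_⟩
  rw [comp_comp (centered_ofLinear B) hθ]
  exact h1 a

/-- Two parametrizations of the same ideal differ by a change of parameters. -/
theorem eq_comp_of_vanishingIdeal_le [Finite α] [Finite β] [Finite γ]
    {θ : β → MvPowerSeries α ℂ} {θ' : β → MvPowerSeries γ ℂ} {hθ : Centered θ} {hθ' : Centered θ'}
    {π : α → MvPowerSeries β ℂ} (hπ : Centered π) (h : ∀ a, comp θ (π a) = X a)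
    (hle : vanishingIdeal θ hθ ≤ vanishingIdeal θ' hθ') (b : β) :
    θ' b = comp (fun a => comp θ' (π a)) (θ b) := by
  -- The relation `θ ∘ π = id` holds on the image of `θ`; the inclusion of ideals transports it to
  -- the image of `θ'`.
  have : comp π (θ b) - X b ∈ vanishingIdeal θ hθ := by
    rw [mem_vanishingIdeal, comp_sub hθ, comp_comp hπ hθ, funext h, comp_id, comp_X hθ, sub_self]
  have := mem_vanishingIdeal.1 (hle this)
  rw [comp_sub hθ', comp_comp hπ hθ', comp_X hθ', sub_eq_zero] at this
  exact this.symm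

/-- The relations `X b - θ_b ∘ π`, with `π` a left inverse of `θ`, already give `v = Dθ (Dπ v)` for
each tangent vector `v`. -/
theorem tangentSpace_vanishingIdeal [Fintype α] [Fintype β] {θ : β → MvPowerSeries α ℂ}
    (hθ : Centered θ) (h : Function.Injective (diff θ)) :
    tangentSpace (vanishingIdeal θ hθ) = LinearMap.range (diff θ) := by
  refine le_antisymm (fun v hv => ?_) ?_
  · obtain ⟨π, hπ, h1⟩ := exists_leftInverse hθ h
    refine ⟨diff π v, funext fun b => ?_⟩
    have hb := hv (X b - comp π (θ b)) (by
      rw [mem_vanishingIdeal, comp_sub hθ, comp_comp hπ hθ, funext h1, comp_id, comp_X hθ,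
        sub_self])
    have h2 : ∑ k, linearPart (X b : MvPowerSeries β ℂ) k * v k = v b :=
      congr_fun (diff_X v) b
    simp only [linearPart_sub, Pi.sub_apply, sub_mul, Finset.sum_sub_distrib, h2] at hb
    rw [← diff_comp hπ, diff_apply]
    exact (sub_eq_zero.1 hb).symm
  · rintro _ ⟨v, rfl⟩ f hf
    have := congr_fun (diff_comp hθ (fun _ : Unit => f) v) ()
    rw [diff_apply, mem_vanishingIdeal.1 hf] at this
    rw [← diff_apply (fun _ : Unit => f) _ (), ← this]
    simp [linearPart_zero]

theorem card_add_finrank_ker [Fintype β] [Fintype κ] {r : κ → MvPowerSeries β ℂ}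
    (hr : LinearIndependent ℂ fun i => linearPart (r i)) :
    Fintype.card κ + Module.finrank ℂ (LinearMap.ker (diff r)) = Fintype.card β := by
  have h1 : Module.finrank ℂ (LinearMap.range (diff r)) = Fintype.card κ :=
    LinearIndependent.rank_matrix (M := Matrix.of fun i k => linearPart (r i) k) hr
  have h2 := LinearMap.finrank_range_add_finrank_ker (diff r)
  rwa [h1, Module.finrank_fintype_fun_eq_card] at h2

theorem diff_eq_zero_iff [Fintype β] {r : κ → MvPowerSeries β ℂ} {v : β → ℂ} :
    diff r v = 0 ↔ ∀ i, ∑ k, linearPart (r i) k * v k = 0 := funext_iff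

/-- Elements of the ideal of a parametrization generate it when their differentials are
independent and their number is the codimension. -/
theorem span_eq_vanishingIdeal [Fintype α] [Fintype β] [Fintype κ] {θ : β → MvPowerSeries α ℂ}
    (hθ : Centered θ) (h : Function.Injective (diff θ)) {r : κ → MvPowerSeries β ℂ}
    (hr : ∀ i, r i ∈ vanishingIdeal θ hθ) (hr0 : Centered r)
    (hli : LinearIndependent ℂ fun i => linearPart (r i))
    (hcard : Fintype.card κ + Fintype.card α = Fintype.card β) :
    Ideal.span (Set.range r) = vanishingIdeal θ hθ := by
  classical
  obtain ⟨B, hB⟩ := (diff θ).exists_leftInverse_of_injective (LinearMap.ker_eq_bot.2 h)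
  have hker : LinearMap.ker (diff r) = LinearMap.range (diff θ) := by
    symm
    apply Submodule.eq_of_le_of_finrank_eq
    · rw [← tangentSpace_vanishingIdeal hθ h]
      exact fun v hv => diff_eq_zero_iff.2 fun i => hv _ (hr i)
    · rw [LinearMap.finrank_range_of_inj h, Module.finrank_fintype_fun_eq_card]
      have := card_add_finrank_ker hli
      omega
  -- The linear functions `B` complete `r` to a coordinate system, because `B` is injective on the
  -- kernel of `Dr`, which is the range of `Dθ`.
  have hinj : Function.Injective (diff (Sum.elim (ofLinear B) r)) := by
    refine (injective_iff_map_eq_zero _).2 fun v hv => ?_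
    have h1 : v ∈ LinearMap.ker (diff r) := funext fun i => congr_fun hv (Sum.inr i)
    rw [hker] at h1
    obtain ⟨w, rfl⟩ := h1
    have h2 : diff (ofLinear B) (diff θ w) = 0 := funext fun i => congr_fun hv (Sum.inl i)
    rw [diff_ofLinear] at h2
    have h3 := LinearMap.congr_fun hB w
    rw [LinearMap.comp_apply, h2] at h3
    rw [← show 0 = w from h3, map_zero]
  have hbij : Function.Bijective (diff (Sum.elim (ofLinear B) r)) := by
    refine ⟨hinj, ?_⟩
    rwa [← LinearMap.injective_iff_surjective_of_finrank_eq_finrank]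
    simp only [Module.finrank_fintype_fun_eq_card, Fintype.card_sum]
    omega
  obtain ⟨θ', hθ', h1, h2⟩ := exists_parametrization (centered_ofLinear B) hr0 hbij
  have hle : Ideal.span (Set.range r) ≤ vanishingIdeal θ hθ :=
    Ideal.span_le.2 (by rintro _ ⟨i, rfl⟩; exact hr i)
  refine le_antisymm hle fun f hf => ?_
  rw [h2] at hle ⊢
  -- Thus `θ = θ' ∘ (B ∘ θ)`, and `B ∘ θ` is an invertible change of parameters, so `θ` and `θ'`
  -- have the same ideal.
  have h3 := eq_comp_of_vanishingIdeal_le (centered_ofLinear B) h1 hle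
  have hφ : Centered fun a => comp θ (ofLinear B a) := Centered.comp (centered_ofLinear B) hθ
  obtain ⟨χ, hχ, -, h4⟩ := exists_inverse_of_diff_eq_id hφ <| LinearMap.ext fun v => by
    rw [diff_comp hθ, diff_ofLinear]
    exact LinearMap.congr_fun hB v
  rw [mem_vanishingIdeal] at hf ⊢
  have h5 : comp (fun a => comp θ (ofLinear B a)) (comp θ' f) = 0 := by
    rw [comp_comp hθ' hφ, ← funext h3, hf]
  have h6 := congrArg (comp χ) h5
  rwa [comp_comp hφ hχ, funext h4, comp_id, comp_zero hχ] at h6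

/-- If the differentials of a subset `S` of the ideal of a parametrization define the tangent
space, then the ideal has a regular system of generators in `S`. -/
theorem exists_generators [Fintype α] [Fintype β] {θ : β → MvPowerSeries α ℂ}
    (hθ : Centered θ) (h : Function.Injective (diff θ)) {S : Set (MvPowerSeries β ℂ)}
    (hS : ∀ f ∈ S, f ∈ vanishingIdeal θ hθ) (hS0 : ∀ f ∈ S, constantCoeff f = 0)
    (ht : ∀ v : β → ℂ, (∀ f ∈ S, ∑ k, linearPart f k * v k = 0) → v ∈ LinearMap.range (diff θ)) :
    ∃ (k : ℕ) (r : Fin k → MvPowerSeries β ℂ), k + Fintype.card α = Fintype.card β ∧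
      (∀ i, r i ∈ S) ∧ LinearIndependent ℂ (fun i => linearPart (r i)) ∧
      vanishingIdeal θ hθ = Ideal.span (Set.range r) := by
  classical
  obtain ⟨b, hb, hspan, hli⟩ := exists_linearIndependent ℂ (linearPart '' S)
  have hfin : Finite b := hli.finite
  obtain ⟨k, ⟨e⟩⟩ := Finite.exists_equiv_fin b
  have hch : ∀ i : Fin k, ∃ f ∈ S, linearPart f = e.symm i := fun i => hb (e.symm i).2
  choose r hrS hr using hch
  have hli' : LinearIndependent ℂ fun i => linearPart (r i) := by
    rw [funext hr]
    exact hli.comp _ e.symm.injective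
  have hker : LinearMap.ker (diff r) = LinearMap.range (diff θ) := by
    refine le_antisymm (fun v hv => ht v fun f hf => ?_) ?_
    · have hm : linearPart f ∈ Submodule.span ℂ b := hspan ▸ Submodule.subset_span ⟨f, hf, rfl⟩
      generalize linearPart f = ℓ at hm
      induction hm using Submodule.span_induction with
      | mem x hx =>
        have := diff_eq_zero_iff.1 hv (e ⟨x, hx⟩)
        rwa [hr, Equiv.symm_apply_apply] at this
      | zero => simp
      | add x y _ _ hx hy => simp [add_mul, Finset.sum_add_distrib, hx, hy]
      | smul c x _ hx => simp [mul_assoc, ← Finset.mul_sum, hx]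
    · rw [← tangentSpace_vanishingIdeal hθ h]
      exact fun v hv => diff_eq_zero_iff.2 fun i => hv _ (hS _ (hrS i))
  have hcard := card_add_finrank_ker hli'
  rw [hker, LinearMap.finrank_range_of_inj h, Module.finrank_fintype_fun_eq_card] at hcard
  exact ⟨k, r, by simpa using hcard, hrS, hli', (span_eq_vanishingIdeal hθ h (fun i => hS _ (hrS i))
    (fun i => hS0 _ (hrS i)) hli' hcard).symm⟩

theorem constantCoeff_eq_zero_of_mem [Finite β] {θ : β → MvPowerSeries α ℂ} {hθ : Centered θ}
    {f : MvPowerSeries β ℂ} (hf : f ∈ vanishingIdeal θ hθ) : constantCoeff f = 0 := by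
  have h1 := constantCoeff_comp hθ (f := f - C (constantCoeff f)) (by simp)
  rw [comp_sub hθ, comp_C, mem_vanishingIdeal.1 hf] at h1
  simpa using h1

theorem isFormalSubmanifold_vanishingIdeal [Fintype α] [Fintype β] {θ : β → MvPowerSeries α ℂ}
    (hθ : Centered θ) (h : Function.Injective (diff θ)) :
    IsFormalSubmanifold (vanishingIdeal θ hθ) (Fintype.card α) := by
  obtain ⟨k, r, h1, h2, h3, h4⟩ := exists_generators hθ h (S := vanishingIdeal θ hθ)
    (fun f hf => hf) (fun f hf => constantCoeff_eq_zero_of_mem hf)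
    (fun v hv => by rw [← tangentSpace_vanishingIdeal hθ h]; exact hv)
  exact ⟨k, r, h1, fun i => constantCoeff_eq_zero_of_mem (h2 i), h3, h4⟩

/-! ### Conjugation -/

instance : Filter.TendstoCofinite (Sum.swap : α ⊕ α → α ⊕ α) :=
  ⟨(Equiv.sumComm α α).injective.tendsto_cofinite⟩

/-- Exhibits conjugation as a composite of ring homomorphisms, from which its algebraic rules
follow. -/
theorem conjugate_eq (f : MvPowerSeries (α ⊕ α) ℂ) :
    conjugate f = rename Sum.swap (map (starRingEnd ℂ) f) := by
  ext n
  have h1 := coeff_embDomain_rename (R := ℂ) (Equiv.sumComm α α).toEmbedding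
    (map (starRingEnd ℂ) f) (n.mapDomain Sum.swap)
  have h2 : Finsupp.embDomain (Equiv.sumComm α α).toEmbedding (n.mapDomain Sum.swap) = n := by
    rw [Finsupp.embDomain_eq_mapDomain]
    change Finsupp.mapDomain Sum.swap _ = n
    rw [← Finsupp.mapDomain_comp]
    simp
  rw [h2] at h1
  exact h1.symm

theorem conjugate_add (f g : MvPowerSeries (α ⊕ α) ℂ) :
    conjugate (f + g) = conjugate f + conjugate g := by simp [conjugate_eq]

theorem conjugate_sub (f g : MvPowerSeries (α ⊕ α) ℂ) :
    conjugate (f - g) = conjugate f - conjugate g := by simp [conjugate_eq]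

theorem conjugate_mul (f g : MvPowerSeries (α ⊕ α) ℂ) :
    conjugate (f * g) = conjugate f * conjugate g := by simp [conjugate_eq]

theorem conjugate_zero : conjugate (0 : MvPowerSeries (α ⊕ α) ℂ) = 0 := by simp [conjugate_eq]

theorem conjugate_smul (c : ℂ) (f : MvPowerSeries (α ⊕ α) ℂ) :
    conjugate (c • f) = starRingEnd ℂ c • conjugate f := by
  simp [conjugate_eq, smul_eq_C_mul, rename_C]

theorem conjugate_X (k : α ⊕ α) : conjugate (X k : MvPowerSeries (α ⊕ α) ℂ) = X k.swap := by
  simp [conjugate_eq, rename_X]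

theorem conjugate_conjugate (f : MvPowerSeries (α ⊕ α) ℂ) : conjugate (conjugate f) = f := by
  ext n
  change starRingEnd ℂ (starRingEnd ℂ (coeff (Finsupp.mapDomain _ (Finsupp.mapDomain _ n)) f)) = _
  rw [Complex.conj_conj, ← Finsupp.mapDomain_comp]
  simp

theorem constantCoeff_conjugate (f : MvPowerSeries (α ⊕ α) ℂ) :
    constantCoeff (conjugate f) = starRingEnd ℂ (constantCoeff f) := by simp [conjugate_eq]

theorem linearPart_conjugate (f : MvPowerSeries (α ⊕ α) ℂ) (k : α ⊕ α) :
    linearPart (conjugate f) k = starRingEnd ℂ (linearPart f k.swap) := by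
  change starRingEnd ℂ (coeff _ f) = _
  rw [Finsupp.mapDomain_single]; rfl

/-- The conjugate of a parametrization. -/
def conjParam (θ : α ⊕ α → MvPowerSeries γ ℂ) : α ⊕ α → MvPowerSeries γ ℂ :=
  fun k => map (starRingEnd ℂ) (θ k.swap)

theorem centered_conjParam {θ : α ⊕ α → MvPowerSeries γ ℂ} (hθ : Centered θ) :
    Centered (conjParam θ) := fun k => by simp [conjParam, hθ]

theorem comp_rename_swap [Finite α] {θ : α ⊕ α → MvPowerSeries γ ℂ} (hθ : Centered θ)
    (f : MvPowerSeries (α ⊕ α) ℂ) :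
    comp θ (rename Sum.swap f) = comp (fun k => θ k.swap) f := by
  rw [rename_eq_subst, comp, subst_comp_subst_apply (HasSubst.X_comp _) hθ.hasSubst]
  congr 1
  funext k
  exact comp_X hθ _

theorem map_conj_comp [Finite α] {θ : α ⊕ α → MvPowerSeries γ ℂ} (hθ : Centered θ)
    (f : MvPowerSeries (α ⊕ α) ℂ) :
    map (starRingEnd ℂ) (comp θ f) = comp (conjParam θ) (conjugate f) := by
  rw [comp, map_subst hθ.hasSubst, conjugate_eq, comp_rename_swap (centered_conjParam hθ)]
  simp [conjParam]

theorem comp_conjParam_eq_zero_iff [Finite α] {θ : α ⊕ α → MvPowerSeries γ ℂ} (hθ : Centered θ)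
    (f : MvPowerSeries (α ⊕ α) ℂ) : comp (conjParam θ) f = 0 ↔ comp θ (conjugate f) = 0 := by
  conv_lhs => rw [← conjugate_conjugate f, ← map_conj_comp hθ]
  refine ⟨fun h => ?_, fun h => by rw [h, map_zero]⟩
  ext n
  have := congrArg (coeff n) h
  simpa using this

theorem conjugate_comp [Finite α] [Finite β] {a : α ⊕ α → MvPowerSeries (β ⊕ β) ℂ}
    (ha : Centered a) (f : MvPowerSeries (α ⊕ α) ℂ) :
    conjugate (comp a f) = comp (fun k => conjugate (a k.swap)) (conjugate f) := by
  rw [conjugate_eq, map_conj_comp ha, rename_eq_subst,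
    subst_comp_subst_apply (centered_conjParam ha).hasSubst (HasSubst.X_comp _)]
  congr 1
  funext k
  rw [conjugate_eq, rename_eq_subst]
  rfl

/-- A conjugation-invariant parametrized ideal defines a formal real submanifold. -/
theorem isRealFormalSubmanifold_vanishingIdeal [Fintype α] [Fintype γ]
    {θ : α ⊕ α → MvPowerSeries γ ℂ} (hθ : Centered θ) (h : Function.Injective (diff θ))
    (hconj : ∀ f ∈ vanishingIdeal θ hθ, conjugate f ∈ vanishingIdeal θ hθ) :
    IsRealFormalSubmanifold (vanishingIdeal θ hθ) (Fintype.card γ) := by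
  obtain ⟨k, r, h1, h2, h3, h4⟩ := exists_generators hθ h
    (S := {f | f ∈ vanishingIdeal θ hθ ∧ conjugate f = f}) (fun f hf => hf.1)
    (fun f hf => constantCoeff_eq_zero_of_mem hf.1) (fun v hv => by
      rw [← tangentSpace_vanishingIdeal hθ h]
      intro f hf
      -- The real elements `f + conj f` and `i (f - conj f)` together recover `f`, so real elements
      -- suffice to cut out the tangent space.
      have e1 := hv (f + conjugate f) ⟨Ideal.add_mem _ hf (hconj f hf), by
        rw [conjugate_add, conjugate_conjugate, add_comm]⟩
      have e2 := hv (Complex.I • (f - conjugate f)) ⟨by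
        rw [smul_eq_C_mul]
        exact Ideal.mul_mem_left _ _ (Ideal.sub_mem _ hf (hconj f hf)), by
          rw [conjugate_smul, conjugate_sub, conjugate_conjugate, Complex.conj_I, neg_smul,
            ← smul_neg, neg_sub]⟩
      simp only [linearPart_add, linearPart_smul, linearPart_sub, Pi.add_apply, Pi.smul_apply,
        Pi.sub_apply, smul_eq_mul, add_mul, sub_mul, mul_assoc, Finset.sum_add_distrib,
        Finset.sum_sub_distrib, ← Finset.mul_sum] at e1 e2
      have e3 := (mul_eq_zero.1 e2).resolve_left Complex.I_ne_zero
      linear_combination (e1 + e3) / 2)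
  exact ⟨k, r, h1, fun i => (h2 i).2, fun i => constantCoeff_eq_zero_of_mem (h2 i).1, h3, h4⟩

/-! ### Invariant formal submanifolds -/

/-- Contact of order `d` between two fixed points improves to order `d + 1`, hence to every order.
-/
theorem fixedPoint_unique (m : ℕ) (Φ : (κ → MvPowerSeries α ℂ) → κ → MvPowerSeries α ℂ)
    (hc : ∀ g g' d, (∀ k, VanishesTo m (g k)) → (∀ k, VanishesTo m (g' k)) →
      (∀ k, VanishesTo d (g k - g' k)) → ∀ k, VanishesTo (d + 1) (Φ g k - Φ g' k))
    {g g' : κ → MvPowerSeries α ℂ} (hg : ∀ k, VanishesTo m (g k)) (hg' : ∀ k, VanishesTo m (g' k))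
    (h : Φ g = g) (h' : Φ g' = g') : g = g' := by
  have key : ∀ d k, VanishesTo d (g k - g' k) := by
    intro d
    induction d with
    | zero => exact fun k => .zero_left _
    | succ d ih =>
      intro k
      have := hc g g' d hg hg' ih k
      rwa [h, h'] at this
  exact funext fun k => eq_of_forall_vanishesTo fun d => key d k

/-- The monomial `x^n` is an eigenvector of composition with `x ↦ ν x`, with eigenvalue `ν^n`; this
produces the divisors of the homological equation. -/
theorem coeff_comp_smul_X [Finite α] (ν : α → ℂ) (f : MvPowerSeries α ℂ) (n : α →₀ ℕ) :
    coeff n (comp (fun a => ν a • X a) f) = (n.prod fun a i => ν a ^ i) * coeff n f := by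
  have := rescale_eq_subst ν f
  rw [← coeff_rescale, this]
  rfl

/-! ### The homological equation for invariant graphs. -/

section graph

variable [Fintype α] [Fintype κ]

/-- The graph of a tuple of series. -/
def graph (g : κ → MvPowerSeries α ℂ) : α ⊕ κ → MvPowerSeries α ℂ := Sum.elim X g

theorem centered_graph {g : κ → MvPowerSeries α ℂ} (hg : Centered g) : Centered (graph g) := by
  rintro (k | k)
  exacts [centered_X k, hg k]

theorem graph_sub_graph {g g' : κ → MvPowerSeries α ℂ} {d : ℕ}
    (h : ∀ k, VanishesTo d (g k - g' k)) (c : α ⊕ κ) : VanishesTo d (graph g c - graph g' c) := by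
  rcases c with c | c
  · simpa [graph] using VanishesTo.zero d
  · exact h c

variable (ν : α → ℂ) (ω : κ → ℂ) (N : α ⊕ κ → MvPowerSeries (α ⊕ κ) ℂ)

/-- The first component of the restriction of the map `(ν x, ω y) + N (x, y)` to the graph of
`g`. -/
def graphBase (g : κ → MvPowerSeries α ℂ) (a : α) : MvPowerSeries α ℂ :=
  ν a • X a + comp (graph g) (N (Sum.inl a))

/-- The remainder in the homological equation for an invariant graph. -/
def graphRem (g : κ → MvPowerSeries α ℂ) (k : κ) : MvPowerSeries α ℂ :=
  comp (graphBase ν N g) (g k) - comp (fun a => ν a • X a) (g k) -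
    comp (graph g) (N (Sum.inr k))

/-- The operator whose fixed points are the invariant graphs. -/
def graphOp (g : κ → MvPowerSeries α ℂ) (k : κ) : MvPowerSeries α ℂ :=
  -- The divisor may vanish in degrees 0 and 1, where non-resonance says nothing; when `g` and `N`
  -- vanish to order two the numerator is zero there, so the quotient is zero.
  fun n => coeff n (graphRem ν N g k) / (ω k - n.prod fun a i => ν a ^ i)

variable {ν ω N}

theorem coeff_graphOp (g : κ → MvPowerSeries α ℂ) (k : κ) (n : α →₀ ℕ) :
    coeff n (graphOp ν ω N g k) =
      coeff n (graphRem ν N g k) / (ω k - n.prod fun a i => ν a ^ i) := rfl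

theorem centered_of_vanishesTo_two {g : κ → MvPowerSeries α ℂ} (hg : ∀ k, VanishesTo 2 (g k)) :
    Centered g := fun k => (vanishesTo_two_iff.1 (hg k)).1

theorem centered_smul_X : Centered fun a => ν a • (X a : MvPowerSeries α ℂ) := fun a => by simp

variable (hN : ∀ c, VanishesTo 2 (N c))
include hN

theorem graphBase_sub {g : κ → MvPowerSeries α ℂ} (hg : ∀ k, VanishesTo 2 (g k)) (a : α) :
    VanishesTo 2 (graphBase ν N g a - ν a • X a) := by
  rw [graphBase, add_sub_cancel_left]
  exact (hN _).comp (centered_graph (centered_of_vanishesTo_two hg))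

theorem centered_graphBase {g : κ → MvPowerSeries α ℂ} (hg : ∀ k, VanishesTo 2 (g k)) :
    Centered (graphBase ν N g) := fun a => by
  have := (vanishesTo_two_iff.1 (graphBase_sub hN hg (ν := ν) a)).1
  rwa [map_sub, centered_smul_X, sub_zero] at this

theorem vanishesTo_graphRem {g : κ → MvPowerSeries α ℂ} (hg : ∀ k, VanishesTo 2 (g k)) (k : κ) :
    VanishesTo 2 (graphRem ν N g k) :=
  (((hg k).comp (centered_graphBase hN hg)).sub ((hg k).comp centered_smul_X)).sub
    ((hN _).comp (centered_graph (centered_of_vanishesTo_two hg)))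

theorem vanishesTo_graphOp {g : κ → MvPowerSeries α ℂ} (hg : ∀ k, VanishesTo 2 (g k)) (k : κ) :
    VanishesTo 2 (graphOp ν ω N g k) := fun n hn => by
  rw [coeff_graphOp, vanishesTo_graphRem hN hg k n hn, zero_div]

theorem graphOp_contraction (g g' : κ → MvPowerSeries α ℂ) (d : ℕ)
    (hg : ∀ k, VanishesTo 2 (g k)) (hg' : ∀ k, VanishesTo 2 (g' k))
    (h : ∀ k, VanishesTo d (g k - g' k)) (k : κ) :
    VanishesTo (d + 1) (graphOp ν ω N g k - graphOp ν ω N g' k) := by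
  rcases Nat.eq_zero_or_pos d with rfl | hd
  · exact ((vanishesTo_graphOp hN hg k).sub (vanishesTo_graphOp hN hg' k)).mono one_le_two
  have hG := centered_graph (centered_of_vanishesTo_two hg)
  have hG' := centered_graph (centered_of_vanishesTo_two hg')
  have hB := centered_graphBase hN hg (ν := ν)
  have hB' := centered_graphBase hN hg' (ν := ν)
  have hNd : ∀ c, VanishesTo (d + 1) (comp (graph g) (N c) - comp (graph g') (N c)) := fun c =>
    (hN c).comp_sub_comp hG hG' hd (graph_sub_graph h) (by omega)
  -- The base map and its linear part agree to order two, which gains one order on the difference `g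
  -- - g'` of order `d`.
  have h1 : VanishesTo (d + 1) (comp (graphBase ν N g) (g k - g' k) -
      comp (fun a => ν a • X a) (g k - g' k)) :=
    (h k).comp_sub_comp hB centered_smul_X one_le_two (graphBase_sub hN hg) (by omega)
  -- The two base maps differ only through `N`, hence agree to order `d + 1`.
  have h2 : VanishesTo (d + 1) (comp (graphBase ν N g) (g' k) - comp (graphBase ν N g') (g' k)) :=
    (hg' k).comp_sub_comp hB hB' (show 1 ≤ d + 1 by omega)
      (fun a => by simpa [graphBase] using hNd (Sum.inl a)) (by omega)
  have key : VanishesTo (d + 1) (graphRem ν N g k - graphRem ν N g' k) := by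
    convert (h1.add h2).sub (hNd (Sum.inr k)) using 1
    rw [comp_sub hB, comp_sub centered_smul_X, graphRem, graphRem]
    ring
  intro n hn
  rw [map_sub, coeff_graphOp, coeff_graphOp, ← sub_div, ← map_sub, key n hn, zero_div]

/-- Subtracting `g(ν x)` from both sides of the invariance equation `ω g + N_y(x, g) = g(ν x +
N_x(x, g))` makes the left side diagonal on monomials, with factor `ω_k - ν^n`; division by this
factor gives `graphOp`. -/
theorem graphOp_eq_iff
    (hres : ∀ (k : κ) (n : α →₀ ℕ), 1 < n.degree → (n.prod fun a i => ν a ^ i) ≠ ω k)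
    {g : κ → MvPowerSeries α ℂ} (hg : ∀ k, VanishesTo 2 (g k)) :
    graphOp ν ω N g = g ↔
      ∀ k, ω k • g k + comp (graph g) (N (Sum.inr k)) = comp (graphBase ν N g) (g k) := by
  have e : ∀ k n, coeff n (ω k • g k + comp (graph g) (N (Sum.inr k)) -
      comp (graphBase ν N g) (g k)) =
      coeff n (g k) * (ω k - n.prod fun a i => ν a ^ i) - coeff n (graphRem ν N g k) := by
    intro k n
    simp only [graphRem, map_sub, map_add, coeff_smul, coeff_comp_smul_X]
    ring
  constructor
  · intro h k
    rw [← sub_eq_zero]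
    ext n
    rw [e, map_zero]
    rcases lt_or_ge n.degree 2 with hn | hn
    · rw [hg k n hn, vanishesTo_graphRem hN hg k n hn, zero_mul, sub_zero]
    · have h1 := congrArg (coeff n) (congr_fun h k)
      rw [coeff_graphOp] at h1
      rw [← h1, div_mul_cancel₀ _ (sub_ne_zero.2 (hres k n hn).symm), sub_self]
  · intro h
    funext k
    ext n
    rcases lt_or_ge n.degree 2 with hn | hn
    · rw [hg k n hn, vanishesTo_graphOp hN hg k n hn]
    · have h1 := e k n
      rw [sub_eq_zero.2 (h k), map_zero, eq_comm, sub_eq_zero] at h1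
      rw [coeff_graphOp, ← h1, mul_div_cancel_right₀ _ (sub_ne_zero.2 (hres k n hn).symm)]

end graph

/-- Linear coordinates `(x, y)` in which a formal map has the differential `(ν x, ω y)`. -/
structure IsDiagonalizedBy [Fintype β] (σ : β → MvPowerSeries β ℂ) (ν : α → ℂ) (ω : κ → ℂ)
    (T : (β → ℂ) ≃ₗ[ℂ] (α ⊕ κ → ℂ)) : Prop where
  inl : ∀ v a, T (diff σ v) (Sum.inl a) = ν a * T v (Sum.inl a)
  inr : ∀ v k, T (diff σ v) (Sum.inr k) = ω k * T v (Sum.inr k)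

/-! ### Invariant submanifolds in the eigencoordinates of the differential. -/

section coordinates

variable [Fintype α] [Fintype β] [Fintype κ] [DecidableEq α] [DecidableEq β] [DecidableEq κ]
  {σ : β → MvPowerSeries β ℂ} {ν : α → ℂ} {ω : κ → ℂ} {T : (β → ℂ) ≃ₗ[ℂ] (α ⊕ κ → ℂ)}

/-- The map `σ` in the coordinates `T`. -/
def inCoordinates (σ : β → MvPowerSeries β ℂ) (T : (β → ℂ) ≃ₗ[ℂ] (α ⊕ κ → ℂ)) (c : α ⊕ κ) :
    MvPowerSeries (α ⊕ κ) ℂ :=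
  comp (ofLinear T.symm.toLinearMap) (comp σ (ofLinear T.toLinearMap c))

/-- The nonlinear part of `σ` in the coordinates `T`. -/
def nonlinearPart (σ : β → MvPowerSeries β ℂ) (ν : α → ℂ) (ω : κ → ℂ)
    (T : (β → ℂ) ≃ₗ[ℂ] (α ⊕ κ → ℂ)) (c : α ⊕ κ) : MvPowerSeries (α ⊕ κ) ℂ :=
  inCoordinates σ T c - Sum.elim ν ω c • X c

theorem vanishesTo_nonlinearPart (hσ : Centered σ) (hT : IsDiagonalizedBy σ ν ω T) (c : α ⊕ κ) :
    VanishesTo 2 (nonlinearPart σ ν ω T c) := by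
  have h0 := Centered.comp (Centered.comp (centered_ofLinear T.toLinearMap) hσ)
    (centered_ofLinear T.symm.toLinearMap)
  refine vanishesTo_two_iff.2 ⟨?_, ?_⟩
  · rw [nonlinearPart, map_sub, inCoordinates, h0]
    simp
  · ext b
    have h1 : diff (inCoordinates σ T) (Pi.single b 1) c =
        T (diff σ (T.symm (Pi.single b 1))) c := by
      unfold inCoordinates
      rw [diff_comp (centered_ofLinear _), diff_comp hσ, diff_ofLinear, diff_ofLinear]
      rfl
    have h2 : diff (inCoordinates σ T) (Pi.single b 1) c = linearPart (inCoordinates σ T c) b := by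
      simp [diff_apply, Pi.single_apply]
    have h3 : T (diff σ (T.symm (Pi.single b 1))) c = Sum.elim ν ω c * (Pi.single b 1 : _ → ℂ) c := by
      rcases c with a | k
      · rw [hT.inl, T.apply_symm_apply]; rfl
      · rw [hT.inr, T.apply_symm_apply]; rfl
    rw [nonlinearPart, linearPart_sub, linearPart_smul, linearPart_X, Pi.sub_apply, ← h2, h1, h3]
    simp [Pi.single_apply, eq_comm]

/-- The parametrization of the graph `y = g (x)`. -/
def graphParam (T : (β → ℂ) ≃ₗ[ℂ] (α ⊕ κ → ℂ)) (g : κ → MvPowerSeries α ℂ) (b : β) :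
    MvPowerSeries α ℂ :=
  comp (graph g) (ofLinear T.symm.toLinearMap b)

theorem centered_graphParam {g : κ → MvPowerSeries α ℂ} (hg : Centered g) :
    Centered (graphParam T g) := Centered.comp (centered_ofLinear _) (centered_graph hg)

theorem comp_graphParam_ofLinear {g : κ → MvPowerSeries α ℂ} (hg : Centered g) (c : α ⊕ κ) :
    comp (graphParam T g) (ofLinear T.toLinearMap c) = graph g c := by
  unfold graphParam
  rw [← comp_comp (centered_ofLinear _) (centered_graph hg), comp_ofLinear_ofLinear]
  have : T.toLinearMap ∘ₗ T.symm.toLinearMap = LinearMap.id := by ext; simp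
  rw [this, ofLinear_id, comp_X (centered_graph hg)]

theorem comp_inCoordinates (hσ : Centered σ) {g : κ → MvPowerSeries α ℂ} (hg : Centered g)
    (c : α ⊕ κ) : comp (graph g) (inCoordinates σ T c) =
      comp (fun b => comp (graphParam T g) (σ b)) (ofLinear T.toLinearMap c) := by
  rw [inCoordinates, comp_comp (centered_ofLinear _) (centered_graph hg)]
  exact comp_comp hσ (centered_graphParam hg) _

theorem comp_graph_inCoordinates {g : κ → MvPowerSeries α ℂ} (hg : Centered g) (c : α ⊕ κ) :
    comp (graph g) (inCoordinates σ T c) =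
      Sum.elim ν ω c • graph g c + comp (graph g) (nonlinearPart σ ν ω T c) := by
  rw [nonlinearPart, comp_sub (centered_graph hg), comp_smul (centered_graph hg),
    comp_X (centered_graph hg)]
  ring

theorem diff_graphParam {g : κ → MvPowerSeries α ℂ} (hg : ∀ k, VanishesTo 2 (g k)) (v : α → ℂ) :
    diff (graphParam T g) v = T.symm (Sum.elim v 0) := by
  unfold graphParam
  rw [diff_comp (centered_graph (centered_of_vanishesTo_two hg)), diff_ofLinear]
  change T.symm _ = _
  congr 1
  funext c
  rcases c with a | k
  · exact congr_fun (diff_X v) a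
  · simp [diff_apply, graph, linearPart_eq_zero (hg k)]

/-- Existence of the invariant formal submanifold under the non-resonance condition. -/
theorem exists_invariant (hσ : Centered σ) (hT : IsDiagonalizedBy σ ν ω T)
    (hres : ∀ (k : κ) (n : α →₀ ℕ), 1 < n.degree → (n.prod fun a i => ν a ^ i) ≠ ω k) :
    ∃ (θ : β → MvPowerSeries α ℂ) (φ : α → MvPowerSeries α ℂ), Centered θ ∧ Centered φ ∧
      (∀ v, diff θ v = T.symm (Sum.elim v 0)) ∧ ∀ b, comp θ (σ b) = comp φ (θ b) := by
  have hN := vanishesTo_nonlinearPart hσ hT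
  obtain ⟨g, hg, hfix⟩ := exists_fixedPoint 2 (graphOp ν ω (nonlinearPart σ ν ω T))
    (fun g hg => vanishesTo_graphOp hN hg) (graphOp_contraction hN)
  have hg0 := centered_of_vanishesTo_two hg
  have hB := centered_graphBase hN hg (ν := ν)
  have hθ := centered_graphParam (T := T) hg0
  rw [graphOp_eq_iff hN hres hg] at hfix
  refine ⟨graphParam T g, graphBase ν (nonlinearPart σ ν ω T) g, hθ, hB, diff_graphParam hg,
    fun b => ?_⟩
  -- In the coordinates `T`, the map `σ` restricted to the graph is the graph over the base map: the
  -- `x`-components by definition, the `y`-components by the fixed-point equation.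
  have h1 : ∀ c, comp (fun b => comp (graphParam T g) (σ b)) (ofLinear T.toLinearMap c) =
      comp (graphBase ν (nonlinearPart σ ν ω T) g) (graph g c) := by
    intro c
    rw [← comp_inCoordinates hσ hg0, comp_graph_inCoordinates (ν := ν) (ω := ω) hg0]
    rcases c with a | k
    · exact (comp_X hB a).symm
    · exact hfix k
  have hid : T.symm.toLinearMap ∘ₗ T.toLinearMap = LinearMap.id := by ext; simp
  have h2 : comp (ofLinear T.toLinearMap) (ofLinear T.symm.toLinearMap b) = X b := by
    rw [comp_ofLinear_ofLinear, hid, ofLinear_id]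
  have h3 : Centered fun b => comp (graphParam T g) (σ b) := Centered.comp hσ hθ
  rw [graphParam, comp_comp (centered_graph hg0) hB, ← funext h1,
    ← comp_comp (centered_ofLinear _) h3, h2, comp_X h3]

/-- Uniqueness of the invariant formal submanifold under the non-resonance condition. -/
theorem exists_graphParam (hσ : Centered σ) (hT : IsDiagonalizedBy σ ν ω T)
    (hres : ∀ (k : κ) (n : α →₀ ℕ), 1 < n.degree → (n.prod fun a i => ν a ^ i) ≠ ω k)
    {θ : β → MvPowerSeries α ℂ} (hθ : Centered θ) (hinj : Function.Injective (diff θ))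
    (htan : ∀ v k, T (diff θ v) (Sum.inr k) = 0)
    (hinv : ∀ f ∈ vanishingIdeal θ hθ, comp σ f ∈ vanishingIdeal θ hθ) :
    ∃ g : κ → MvPowerSeries α ℂ, ∃ hg : ∀ k, VanishesTo 2 (g k),
      graphOp ν ω (nonlinearPart σ ν ω T) g = g ∧ vanishingIdeal θ hθ =
        vanishingIdeal (graphParam T g) (centered_graphParam (centered_of_vanishesTo_two hg)) := by
  have hN := vanishesTo_nonlinearPart hσ hT
  have hφ : Centered fun c => comp θ (ofLinear T.toLinearMap c) :=
    Centered.comp (centered_ofLinear _) hθ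
  have hdφ : ∀ v c, diff (fun c => comp θ (ofLinear T.toLinearMap c)) v c = T (diff θ v) c := by
    intro v c
    rw [diff_comp hθ, diff_ofLinear]; rfl
  have hx : Centered fun a => comp θ (ofLinear T.toLinearMap (Sum.inl a)) := fun a => hφ _
  -- The tangent space is `{y = 0}`, so the `x`-coordinates can serve as parameters and the
  -- submanifold becomes a graph.
  have hbij : Function.Bijective (diff fun a => comp θ (ofLinear T.toLinearMap (Sum.inl a))) := by
    have h1 : Function.Injective
        (diff fun a => comp θ (ofLinear T.toLinearMap (Sum.inl a))) := by
      refine (injective_iff_map_eq_zero _).2 fun v hv => hinj ?_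
      rw [map_zero]
      refine T.injective ?_
      rw [map_zero]
      funext c
      rcases c with a | k
      · rw [← hdφ]; exact congr_fun hv a
      · exact htan v k
    exact ⟨h1, LinearMap.injective_iff_surjective.1 h1⟩
  obtain ⟨χ, hχ, h1, h2⟩ := exists_inverse hx hbij
  set g : κ → MvPowerSeries α ℂ := fun k => comp χ (comp θ (ofLinear T.toLinearMap (Sum.inr k)))
    with hgdef
  have hg : ∀ k, VanishesTo 2 (g k) := fun k => by
    refine vanishesTo_two_iff.2 ⟨Centered.comp (fun c => hφ (Sum.inr c)) hχ k, ?_⟩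
    ext a
    have e1 : diff g (Pi.single a 1) k = 0 := by
      rw [hgdef, diff_comp hχ]
      exact (hdφ _ (Sum.inr k)).trans (htan _ k)
    simpa [diff_apply, Pi.single_apply] using e1
  have hg0 := centered_of_vanishesTo_two hg
  have hid : T.symm.toLinearMap ∘ₗ T.toLinearMap = LinearMap.id := by ext; simp
  have hgraph : ∀ c, graph g c = comp χ (comp θ (ofLinear T.toLinearMap c)) := by
    rintro (a | k)
    · exact (h2 a).symm
    · rfl
  have hparam : ∀ b, graphParam T g b = comp χ (θ b) := fun b => by
    rw [graphParam, funext hgraph, ← comp_comp hφ hχ, ← comp_comp (centered_ofLinear _) hθ,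
      comp_ofLinear_ofLinear, hid, ofLinear_id, comp_X hθ]
  have hgp := centered_graphParam (T := T) hg0
  have hideal : vanishingIdeal θ hθ = vanishingIdeal (graphParam T g) hgp := by
    ext f
    rw [mem_vanishingIdeal, mem_vanishingIdeal, funext hparam, ← comp_comp hθ hχ]
    refine ⟨fun h => by rw [h, comp_zero hχ], fun h => ?_⟩
    have := congrArg (comp fun a => comp θ (ofLinear T.toLinearMap (Sum.inl a))) h
    rwa [comp_comp hχ hx, funext h1, comp_id, comp_zero hx] at this
  refine ⟨g, hg, ?_, hideal⟩
  rw [graphOp_eq_iff hN hres hg]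
  have hσg : Centered fun b => comp (graphParam T g) (σ b) := Centered.comp hσ hgp
  have hle : vanishingIdeal (graphParam T g) hgp ≤ vanishingIdeal _ hσg := fun f hf => by
    rw [← hideal] at hf
    have := hinv f hf
    rw [hideal, mem_vanishingIdeal, comp_comp hσ hgp] at this
    exact mem_vanishingIdeal.2 this
  -- By invariance, `σ` maps the graph into itself, so it factors through a map of the parameters;
  -- its `x`-components identify that map as `graphBase`.
  have h3 := eq_comp_of_vanishingIdeal_le (π := fun a => ofLinear T.toLinearMap (Sum.inl a))
    (fun a => centered_ofLinear _ _) (fun a => comp_graphParam_ofLinear hg0 (Sum.inl a)) hle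
  have hbase : ∀ a, comp (fun b => comp (graphParam T g) (σ b))
      (ofLinear T.toLinearMap (Sum.inl a)) = graphBase ν (nonlinearPart σ ν ω T) g a := fun a => by
    rw [← comp_inCoordinates hσ hg0, comp_graph_inCoordinates (ν := ν) (ω := ω) hg0]
    rfl
  rw [funext hbase] at h3
  intro k
  have h4 := comp_graph_inCoordinates (σ := σ) (T := T) (ν := ν) (ω := ω) hg0 (Sum.inr k)
  rw [comp_inCoordinates hσ hg0, funext h3,
    ← comp_comp hgp (centered_graphBase hN hg), comp_graphParam_ofLinear hg0] at h4
  exact h4.symm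

/-- Both submanifolds are graphs of fixed points of the same formal contraction. -/
theorem invariant_unique (hσ : Centered σ) (hT : IsDiagonalizedBy σ ν ω T)
    (hres : ∀ (k : κ) (n : α →₀ ℕ), 1 < n.degree → (n.prod fun a i => ν a ^ i) ≠ ω k)
    {θ θ' : β → MvPowerSeries α ℂ} (hθ : Centered θ) (hθ' : Centered θ')
    (hinj : Function.Injective (diff θ)) (hinj' : Function.Injective (diff θ'))
    (htan : ∀ v k, T (diff θ v) (Sum.inr k) = 0) (htan' : ∀ v k, T (diff θ' v) (Sum.inr k) = 0)
    (hinv : ∀ f ∈ vanishingIdeal θ hθ, comp σ f ∈ vanishingIdeal θ hθ)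
    (hinv' : ∀ f ∈ vanishingIdeal θ' hθ', comp σ f ∈ vanishingIdeal θ' hθ') :
    vanishingIdeal θ hθ = vanishingIdeal θ' hθ' := by
  obtain ⟨g, hg, h1, h2⟩ := exists_graphParam hσ hT hres hθ hinj htan hinv
  obtain ⟨g', hg', h1', h2'⟩ := exists_graphParam hσ hT hres hθ' hinj' htan' hinv'
  obtain rfl := fixedPoint_unique 2 _
    (graphOp_contraction (vanishesTo_nonlinearPart hσ hT)) hg hg' h1 h1'
  rw [h2, h2']

end coordinates

/-! ### The deck transformation `τ₁` -/

/-- The tangent space of an ideal is defined by the differentials of generators. -/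
theorem mem_tangentSpace_span [Fintype β] {r : κ → MvPowerSeries β ℂ} (hr : Centered r)
    {v : β → ℂ} (hv : ∀ i, ∑ k, linearPart (r i) k * v k = 0) :
    v ∈ tangentSpace (Ideal.span (Set.range r)) := by
  intro f hf
  -- The constant term is carried along because the product rule needs it to vanish when a generator
  -- is multiplied by an arbitrary series.
  refine (?_ : constantCoeff f = 0 ∧ ∑ k, linearPart f k * v k = 0).2
  induction hf using Submodule.span_induction with
  | mem x hx =>
    obtain ⟨k, rfl⟩ := hx
    exact ⟨hr k, hv k⟩
  | zero => simp [linearPart_zero]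
  | add x y _ _ hx hy =>
    simp [linearPart_add, add_mul, Finset.sum_add_distrib, hx.1, hx.2, hy.1, hy.2]
  | smul a x _ hx =>
    refine ⟨by simp [hx.1], ?_⟩
    rw [smul_eq_mul, linearPart_mul, hx.1, zero_smul, add_zero]
    simp [mul_assoc, ← Finset.mul_sum, hx.2]

/-- The projection of `W` to the `z'`-space is onto between spaces of equal dimension, hence
injective. -/
theorem eq_zero_of_inl_eq_zero {ι : Type} [Fintype ι] [Finite κ] {W : Submodule ℂ (ι ⊕ κ → ℂ)}
    (hW : Module.finrank ℂ W = Fintype.card ι)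
    (h : ∀ z : ι → ℂ, ∃ v ∈ W, ∀ i, v (Sum.inl i) = z i)
    {v : ι ⊕ κ → ℂ} (hv : v ∈ W) (hv0 : ∀ i, v (Sum.inl i) = 0) : v = 0 := by
  set L : W →ₗ[ℂ] (ι → ℂ) := (LinearMap.funLeft ℂ ℂ Sum.inl) ∘ₗ W.subtype with hL
  have hsurj : Function.Surjective L := fun z => by
    obtain ⟨v, hv, h⟩ := h z
    exact ⟨⟨v, hv⟩, funext h⟩
  have hinj := (LinearMap.injective_iff_surjective_of_finrank_eq_finrank
    (hW.trans (Module.finrank_fintype_fun_eq_card (R := ℂ) (η := ι)).symm)).2 hsurj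
  have h0 : L ⟨v, hv⟩ = L 0 := (funext hv0).trans (map_zero L).symm
  exact congrArg Subtype.val (hinj h0)

section deck

variable {ι : Type} [Fintype ι] {q : ι → MvPowerSeries (ι ⊕ ι) ℂ}

/-- The coordinates `(z', q)`. -/
def squareCoords (q : ι → MvPowerSeries (ι ⊕ ι) ℂ) : ι ⊕ ι → MvPowerSeries (ι ⊕ ι) ℂ :=
  Sum.elim (fun j => X (Sum.inl j)) q

/-- The series `q` vanish at the origin and form, together with `z'`, formal coordinates. -/
structure IsTransverse (q : ι → MvPowerSeries (ι ⊕ ι) ℂ) : Prop where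
  centered : Centered q
  bijective : Function.Bijective (diff (squareCoords q))

theorem IsTransverse.centered_squareCoords (hq : IsTransverse q) : Centered (squareCoords q) := by
  rintro (j | j)
  exacts [centered_X _, hq.centered j]

/-- A formal map is determined by its components in the coordinates `(z', q)`. -/
theorem IsTransverse.eq_of_comp_eq [Finite γ] (hq : IsTransverse q)
    {a b : ι ⊕ ι → MvPowerSeries γ ℂ} (ha : Centered a) (hb : Centered b)
    (hl : ∀ j, a (Sum.inl j) = b (Sum.inl j)) (hr : ∀ j, comp a (q j) = comp b (q j)) : a = b := by
  obtain ⟨ψ, hψ, h1, -⟩ := exists_inverse hq.centered_squareCoords hq.bijective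
  have h : (fun c => comp a (squareCoords q c)) = fun c => comp b (squareCoords q c) := by
    funext c
    rcases c with j | j
    · exact (comp_X ha _).trans ((hl j).trans (comp_X hb _).symm)
    · exact hr j
  funext k
  rw [← comp_X ha k, ← comp_X hb k, ← h1, comp_comp hq.centered_squareCoords ha,
    comp_comp hq.centered_squareCoords hb, h]

/-- The formal map `q ↦ -q` in the coordinates `(z', q)`. -/
structure IsReflection (q : ι → MvPowerSeries (ι ⊕ ι) ℂ) (τ : ι ⊕ ι → MvPowerSeries (ι ⊕ ι) ℂ) :
    Prop where
  centered : Centered τ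
  inl : ∀ j, τ (Sum.inl j) = X (Sum.inl j)
  comp : ∀ j, CRSing.comp τ (q j) = -q j

variable {τ τ' : ι ⊕ ι → MvPowerSeries (ι ⊕ ι) ℂ}

theorem IsTransverse.exists_isReflection (hq : IsTransverse q) : ∃ τ, IsReflection q τ := by
  obtain ⟨ψ, hψ, -, h2⟩ := exists_inverse hq.centered_squareCoords hq.bijective
  have hm : Centered (squareCoords fun j => -q j) := by
    rintro (j | j)
    · exact centered_X _
    · simp [squareCoords, hq.centered j]
  have h : ∀ c, comp (fun k => comp (squareCoords fun j => -q j) (ψ k)) (squareCoords q c) =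
      squareCoords (fun j => -q j) c := fun c => by
    rw [← comp_comp hψ hm, h2, comp_X hm]
  have hτ : Centered fun k => comp (squareCoords fun j => -q j) (ψ k) := Centered.comp hψ hm
  exact ⟨_, hτ, fun j => by rw [← comp_X hτ (Sum.inl j)]; exact h (Sum.inl j),
    fun j => h (Sum.inr j)⟩

theorem IsReflection.unique (hq : IsTransverse q) (h : IsReflection q τ) (h' : IsReflection q τ') :
    τ = τ' :=
  hq.eq_of_comp_eq h.centered h'.centered (fun j => by rw [h.inl, h'.inl])
    fun j => by rw [h.comp, h'.comp]

theorem IsReflection.involutive (hq : IsTransverse q) (h : IsReflection q τ) (k : ι ⊕ ι) :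
    CRSing.comp τ (τ k) = X k := by
  refine congr_fun (hq.eq_of_comp_eq (a := fun k => CRSing.comp τ (τ k)) (b := X)
    (Centered.comp h.centered h.centered) centered_X (fun j => ?_) fun j => ?_) k
  · rw [h.inl, comp_X h.centered, h.inl]
  · rw [← comp_comp h.centered h.centered, h.comp, comp_neg h.centered, h.comp, neg_neg, comp_id]

theorem IsReflection.diff_diff (hq : IsTransverse q) (h : IsReflection q τ) (v : ι ⊕ ι → ℂ) :
    diff τ (diff τ v) = v := by
  rw [← diff_comp h.centered, funext (h.involutive hq), diff_X]

theorem diff_squareCoords_inl (v : ι ⊕ ι → ℂ) (j : ι) :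
    diff (squareCoords q) v (Sum.inl j) = v (Sum.inl j) := congr_fun (diff_X v) (Sum.inl j)

theorem diff_inl_of_eq_X (h : ∀ j, τ (Sum.inl j) = X (Sum.inl j)) (v : ι ⊕ ι → ℂ) (j : ι) :
    diff τ v (Sum.inl j) = v (Sum.inl j) := by
  rw [diff_apply, h]
  exact congr_fun (diff_X v) (Sum.inl j)

/-- The differential of the reflection is `-1` on `{z' = 0}`. -/
theorem IsReflection.diff_eq_neg (hq : IsTransverse q) (h : IsReflection q τ) {v : ι ⊕ ι → ℂ}
    (hv : ∀ j, v (Sum.inl j) = 0) : diff τ v = -v := by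
  refine hq.bijective.1 ?_
  funext c
  rw [← diff_comp h.centered, map_neg, Pi.neg_apply]
  rcases c with j | j
  · rw [diff_comp h.centered, diff_squareCoords_inl, diff_squareCoords_inl, diff_inl_of_eq_X h.inl,
      hv, neg_zero]
  · change ∑ k, linearPart (CRSing.comp τ (q j)) k * v k = -∑ k, linearPart (q j) k * v k
    rw [h.comp, linearPart_neg]
    simp

theorem IsReflection.isTauOne [DecidableEq ι] (hq : IsTransverse q) (h : IsReflection q τ) :
    IsTauOne (fun j => q j ^ 2) τ := by
  refine ⟨⟨h.centered, ?_, h.inl, fun j => ?_⟩, ?_⟩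
  · have hinv : Function.Injective (jacobian τ).mulVec :=
      Function.LeftInverse.injective (g := (jacobian τ).mulVec) (h.diff_diff hq)
    exact (Matrix.isUnit_iff_isUnit_det _).1 (Matrix.mulVec_injective_iff_isUnit.1 hinv)
  · rw [comp_pow h.centered, h.comp, neg_sq]
  · set e := (Fintype.equivFin ι).symm
    refine ⟨Fintype.card ι, fun i => τ (Sum.inr (e i)) - X (Sum.inr (e i)), by simp,
      fun i => by simp [h.centered _], ?_, ?_⟩
    · rw [← linearIndependent_equiv (Fintype.equivFin ι)]
      rw [Fintype.linearIndependent_iff]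
      intro c hc i
      -- Since `Dτ = -1` on `{z' = 0}`, the `w'`-block of the differential of `τ - id` is `-2` times
      -- the identity, whence independence.
      have hv := h.diff_eq_neg hq (v := Pi.single (Sum.inr i) 1) (by simp)
      have h1 := congr_fun hc (Sum.inr i)
      have h2 : ∀ j, linearPart (τ (Sum.inr j)) (Sum.inr i) = -(Pi.single i 1 : ι → ℂ) j := by
        intro j
        have := congr_fun hv (Sum.inr j)
        simpa [diff_apply, Pi.single_apply] using this
      have h3 : ∀ j, linearPart (X (Sum.inr j) : MvPowerSeries (ι ⊕ ι) ℂ) (Sum.inr i) =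
          (Pi.single i 1 : ι → ℂ) j := fun j => by
        simp [linearPart_X, Pi.single_apply, eq_comm]
      simp only [Function.comp_apply, e, Equiv.symm_apply_apply, linearPart_sub, Finset.sum_apply,
        Pi.smul_apply, Pi.sub_apply, h2, h3, smul_eq_mul, Pi.zero_apply] at h1
      simp only [Pi.single_apply] at h1
      rw [Finset.sum_eq_single i (fun j _ hj => by simp [hj]) (by simp)] at h1
      simp only [if_true] at h1
      have h4 : c i * (-2) = 0 := by rw [← h1]; ring
      simpa using h4
    · refine le_antisymm (Ideal.span_le.2 ?_) (Ideal.span_mono ?_)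
      · rintro _ ⟨k | k, rfl⟩
        · simp [h.inl]
        · refine Ideal.subset_span ⟨Fintype.equivFin ι k, ?_⟩
          simp [e]
      · rintro _ ⟨i, rfl⟩
        exact ⟨Sum.inr (e i), rfl⟩

theorem IsTauOne.isReflection [DecidableEq ι] (hq : IsTransverse q)
    (h : IsTauOne (fun j => q j ^ 2) τ) : IsReflection q τ := by
  obtain ⟨⟨hτ, -, hinl, hcomp⟩, k, r, hk, hr0, hli, hspan⟩ := h
  refine ⟨hτ, hinl, fun j => ?_⟩
  have hs : ∀ j, comp τ (q j) = q j ∨ comp τ (q j) = -q j := fun j => by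
    have := hcomp j
    rwa [comp_pow hτ, sq_eq_sq_iff_eq_or_eq_neg] at this
  refine (hs j).resolve_left fun hj => ?_
  -- Fixed vectors of `Dτ` are tangent to the fixed-point set, whose tangent space has dimension
  -- `p`.
  have hfix : ∀ v, diff τ v = v → v ∈ LinearMap.ker (diff r) := by
    intro v hv
    refine diff_eq_zero_iff.2 fun i => ?_
    have hm : r i ∈ Ideal.span (Set.range fun k => τ k - X k) := hspan ▸ Ideal.subset_span ⟨i, rfl⟩
    refine mem_tangentSpace_span (fun k => by simp [hτ k]) (fun k => ?_) _ hm
    have h1 := congr_fun hv k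
    have h2 := congr_fun (diff_X v) k
    rw [diff_apply] at h1 h2
    simp [linearPart_sub, sub_mul, h1, h2]
  have hτq : ∀ v i, diff q (diff τ v) i = diff q v i ∨ diff q (diff τ v) i = -diff q v i := by
    intro v i
    rw [← diff_comp hτ, diff_apply, diff_apply]
    refine (hs i).imp (fun h => by rw [h]) fun h => ?_
    rw [h, linearPart_neg]; simp
  have hfix' : ∀ v, (∀ i, diff q (diff τ v) i = diff q v i) → diff τ v = v := by
    intro v hv
    refine hq.bijective.1 (funext fun c => ?_)
    rcases c with i | i
    · rw [diff_squareCoords_inl, diff_squareCoords_inl, diff_inl_of_eq_X hinl]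
    · exact hv i
  -- On `{dq = 0}` the choice of signs is immaterial, so these vectors are fixed, and they project
  -- onto the whole `z'`-space.
  have hsurj : ∀ z : ι → ℂ, ∃ v ∈ LinearMap.ker (diff r), ∀ i, v (Sum.inl i) = z i := by
    intro z
    obtain ⟨v, hv⟩ := hq.bijective.2 (Sum.elim z 0)
    refine ⟨v, hfix v (hfix' v fun i => ?_), fun i => ?_⟩
    · have h0 : diff q v i = 0 := congr_fun hv (Sum.inr i)
      rcases hτq v i with h | h <;> rw [h]
      rw [h0, neg_zero]
    · have := congr_fun hv (Sum.inl i)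
      rwa [diff_squareCoords_inl] at this
  have hfin : Module.finrank ℂ (LinearMap.ker (diff r)) = Fintype.card ι := by
    have := card_add_finrank_ker hli
    rw [Fintype.card_fin] at this
    omega
  -- A plus sign at `j` makes the vector with `z' = 0` and `dq = e_j` fixed as well; the kernel of
  -- `Dr` has no room for it.
  obtain ⟨v, hv⟩ := hq.bijective.2 (Pi.single (Sum.inr j) 1)
  have hvq : ∀ i, diff q v i = (Pi.single (Sum.inr j) 1 : ι ⊕ ι → ℂ) (Sum.inr i) := fun i =>
    congr_fun hv (Sum.inr i)
  have hvm : v ∈ LinearMap.ker (diff r) := hfix v <| hfix' v fun i => by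
    rcases eq_or_ne i j with rfl | hij
    · rw [← diff_comp hτ, diff_apply, diff_apply, hj]
    · have h0 : diff q v i = 0 := by rw [hvq]; simp [hij]
      rcases hτq v i with h | h <;> rw [h]
      rw [h0, neg_zero]
  have hv1 : v = 0 := eq_zero_of_inl_eq_zero hfin hsurj hvm fun i => by
    have := congr_fun hv (Sum.inl i)
    rwa [diff_squareCoords_inl, Pi.single_eq_of_ne (by simp)] at this
  have := hvq j
  rw [hv1, map_zero] at this
  simp at this

end deck

/-! ### Real submanifolds of `M` and their complexifications -/

/-- The antiholomorphic involution `(z', w') ↦ (w̄', z̄')`. -/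
def conjVec (v : α ⊕ α → ℂ) : α ⊕ α → ℂ := fun k => starRingEnd ℂ (v k.swap)

theorem conjVec_mem_tangentSpace [Fintype α] {I : Ideal (MvPowerSeries (α ⊕ α) ℂ)}
    (hI : ∀ f ∈ I, conjugate f ∈ I) {v : α ⊕ α → ℂ} (hv : v ∈ tangentSpace I) :
    conjVec v ∈ tangentSpace I := by
  intro f hf
  have h1 := congrArg (starRingEnd ℂ) (hv _ (hI f hf))
  rw [map_sum, map_zero] at h1
  rw [← h1, ← (Equiv.sumComm α α).sum_comp]
  refine Finset.sum_congr rfl fun k _ => ?_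
  rw [map_mul, linearPart_conjugate, Complex.conj_conj]
  simp [conjVec]

section ambient

variable {ι : Type} {F : ι → MvPowerSeries (ι ⊕ ι) ℂ}

/-- The parametrization `(z', F(z', w'), w', F̄(w', z'))` of the complexification of `M`. -/
def ambient (F : ι → MvPowerSeries (ι ⊕ ι) ℂ) :
    (ι ⊕ ι) ⊕ (ι ⊕ ι) → MvPowerSeries (ι ⊕ ι) ℂ :=
  Sum.elim (Sum.elim (fun j => X (Sum.inl j)) F)
    (Sum.elim (fun j => X (Sum.inr j)) (fun j => conjugate (F j)))

/-- The coordinates `(z', w')` as functions on the complexified ambient space. -/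
def baseCoords (ι : Type) : ι ⊕ ι → MvPowerSeries ((ι ⊕ ι) ⊕ (ι ⊕ ι)) ℂ :=
  Sum.elim (fun j => X (Sum.inl (Sum.inl j))) (fun j => X (Sum.inr (Sum.inl j)))

theorem centered_baseCoords : Centered (baseCoords ι) := by
  rintro (j | j) <;> simp [baseCoords]

theorem conjugate_baseCoords (k : ι ⊕ ι) : conjugate (baseCoords ι k.swap) = baseCoords ι k := by
  rcases k with j | j <;> exact conjugate_X _

theorem conjugate_ambient (k : (ι ⊕ ι) ⊕ (ι ⊕ ι)) :
    conjugate (ambient F k.swap) = ambient F k := by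
  rcases k with (j | j) | (j | j)
  · exact conjugate_X _
  · exact conjugate_conjugate _
  · exact conjugate_X _
  · rfl

theorem centered_ambient (hF : Centered F) : Centered (ambient F) := by
  rintro ((j | j) | (j | j))
  · exact centered_X _
  · exact hF j
  · exact centered_X _
  · simp [ambient, constantCoeff_conjugate, hF j]

/-- The parametrization of a submanifold of the ambient space over a submanifold of `𝓜`. -/
def ambientParam (F : ι → MvPowerSeries (ι ⊕ ι) ℂ) [Finite ι] (θ : ι ⊕ ι → MvPowerSeries γ ℂ) :
    (ι ⊕ ι) ⊕ (ι ⊕ ι) → MvPowerSeries γ ℂ := fun k => comp θ (ambient F k)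

variable [Fintype ι] {θ : ι ⊕ ι → MvPowerSeries γ ℂ}

theorem centered_ambientParam (hF : Centered F) (hθ : Centered θ) : Centered (ambientParam F θ) :=
  Centered.comp (centered_ambient hF) hθ

theorem comp_ambientParam (hF : Centered F) (hθ : Centered θ) (f) :
    comp (ambientParam F θ) f = comp θ (comp (ambient F) f) :=
  (comp_comp (centered_ambient hF) hθ f).symm

theorem comp_ambient_baseCoords (hF : Centered F) (f : MvPowerSeries (ι ⊕ ι) ℂ) :
    comp (ambient F) (comp (baseCoords ι) f) = f := by
  rw [comp_comp centered_baseCoords (centered_ambient hF)]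
  conv_rhs => rw [← comp_id f]
  congr 1
  funext k
  rcases k with j | j <;> exact comp_X (centered_ambient hF) _

/-- Series in `(z', w')` lift to the ambient space through `baseCoords`, a right inverse of
restriction to the complexification of `M`. -/
theorem complexification_vanishingIdeal (hF : Centered F) (hθ : Centered θ) :
    complexification F (vanishingIdeal (ambientParam F θ) (centered_ambientParam hF hθ)) =
      vanishingIdeal θ hθ := by
  change Ideal.span (comp (ambient F) '' _) = _
  refine le_antisymm (Ideal.span_le.2 ?_) fun f hf => Ideal.subset_span ?_
  · rintro _ ⟨f, hf, rfl⟩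
    rw [SetLike.mem_coe, mem_vanishingIdeal, comp_ambientParam hF hθ] at hf
    exact mem_vanishingIdeal.2 hf
  · refine ⟨comp (baseCoords ι) f, ?_, comp_ambient_baseCoords hF f⟩
    rw [SetLike.mem_coe, mem_vanishingIdeal, comp_ambientParam hF hθ, comp_ambient_baseCoords hF]
    exact mem_vanishingIdeal.1 hf

theorem idealM_le_iff {J : Ideal (MvPowerSeries ((ι ⊕ ι) ⊕ (ι ⊕ ι)) ℂ)} :
    idealM F ≤ J ↔ (∀ j, X (Sum.inl (Sum.inr j)) - comp (baseCoords ι) (F j) ∈ J) ∧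
      ∀ j, X (Sum.inr (Sum.inr j)) - comp (baseCoords ι) (conjugate (F j)) ∈ J := by
  change Ideal.span (Set.range (fun j => X (Sum.inl (Sum.inr j)) - comp (baseCoords ι) (F j)) ∪
    Set.range fun j => X (Sum.inr (Sum.inr j)) - comp (baseCoords ι) (conjugate (F j))) ≤ J ↔ _
  rw [Ideal.span_le, Set.union_subset_iff, Set.range_subset_iff, Set.range_subset_iff]
  rfl

theorem idealM_le_vanishingIdeal (hF : Centered F) (hθ : Centered θ) :
    idealM F ≤ vanishingIdeal (ambientParam F θ) (centered_ambientParam hF hθ) := by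
  have hA := centered_ambient hF
  refine idealM_le_iff.2 ⟨fun j => ?_, fun j => ?_⟩ <;>
  · rw [mem_vanishingIdeal, comp_ambientParam hF hθ, comp_sub hA, comp_ambient_baseCoords hF,
      comp_X hA]
    simp [ambient, comp_zero hθ]

theorem conjugate_mem_ambient (hF : Centered F) (hθ : Centered θ)
    (hconj : ∀ f ∈ vanishingIdeal θ hθ, conjugate f ∈ vanishingIdeal θ hθ) :
    ∀ f ∈ vanishingIdeal (ambientParam F θ) (centered_ambientParam hF hθ),
      conjugate f ∈ vanishingIdeal (ambientParam F θ) (centered_ambientParam hF hθ) := by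
  intro f hf
  rw [mem_vanishingIdeal, comp_ambientParam hF hθ] at hf ⊢
  have := mem_vanishingIdeal.1 (hconj _ (mem_vanishingIdeal.2 hf))
  rwa [conjugate_comp (centered_ambient hF), funext conjugate_ambient] at this

/-! ### Tangent spaces of real submanifolds of `M`. -/

section diff

variable [Fintype γ]

theorem linearPart_ambient_inl_inr (hF2 : ∀ j, VanishesTo 2 (F j)) (j : ι) :
    linearPart (ambient F (Sum.inl (Sum.inr j))) = 0 := linearPart_eq_zero (hF2 j)

theorem linearPart_ambient_inr_inr (hF2 : ∀ j, VanishesTo 2 (F j)) (j : ι) :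
    linearPart (ambient F (Sum.inr (Sum.inr j))) = 0 := by
  ext k
  change linearPart (conjugate (F j)) k = 0
  rw [linearPart_conjugate, linearPart_eq_zero (hF2 j)]
  simp

theorem diff_ambientParam (hF2 : ∀ j, VanishesTo 2 (F j)) (hθ : Centered θ) (u : γ → ℂ) :
    diff (ambientParam F θ) u = Sum.elim (Sum.elim (fun j => diff θ u (Sum.inl j)) 0)
      (Sum.elim (fun j => diff θ u (Sum.inr j)) 0) := by
  unfold ambientParam
  rw [diff_comp hθ]
  funext k
  rcases k with (j | j) | (j | j)
  · exact congr_fun (diff_X (diff θ u)) (Sum.inl j)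
  · rw [diff_apply, linearPart_ambient_inl_inr hF2]; simp
  · exact congr_fun (diff_X (diff θ u)) (Sum.inr j)
  · rw [diff_apply, linearPart_ambient_inr_inr hF2]; simp

theorem diff_ambientParam_injective (hF2 : ∀ j, VanishesTo 2 (F j)) (hθ : Centered θ)
    (hinj : Function.Injective (diff θ)) : Function.Injective (diff (ambientParam F θ)) := by
  intro u u' h
  rw [diff_ambientParam hF2 hθ, diff_ambientParam hF2 hθ] at h
  refine hinj (funext fun k => ?_)
  rcases k with j | j
  · exact congr_fun h (Sum.inl (Sum.inl j))
  · exact congr_fun h (Sum.inr (Sum.inl j))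

/-- As `F` vanishes to order two, the `z''`-components of tangent vectors vanish; real tangent
vectors correspond to the `ρ`-fixed vectors in the range of `Dθ`. -/
theorem mem_realTangentSpace_ambient (hF2 : ∀ j, VanishesTo 2 (F j)) (hθ : Centered θ)
    (hinj : Function.Injective (diff θ)) {v : ι ⊕ ι → ℂ} :
    v ∈ realTangentSpace (vanishingIdeal (ambientParam F θ)
      (centered_ambientParam (centered_of_vanishesTo_two hF2) hθ)) ↔
      (∀ j, v (Sum.inr j) = 0) ∧ (Sum.elim (fun j => v (Sum.inl j))
        (fun j => starRingEnd ℂ (v (Sum.inl j))) : ι ⊕ ι → ℂ) ∈ LinearMap.range (diff θ) := by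
  change _ ∈ tangentSpace _ ↔ _
  rw [tangentSpace_vanishingIdeal _ (diff_ambientParam_injective hF2 hθ hinj)]
  constructor
  · rintro ⟨u, hu⟩
    rw [diff_ambientParam hF2 hθ] at hu
    refine ⟨fun j => (congr_fun hu (Sum.inl (Sum.inr j))).symm, u, funext fun k => ?_⟩
    rcases k with j | j
    · exact congr_fun hu (Sum.inl (Sum.inl j))
    · exact congr_fun hu (Sum.inr (Sum.inl j))
  · rintro ⟨h0, u, hu⟩
    refine ⟨u, ?_⟩
    rw [diff_ambientParam hF2 hθ, hu]
    funext k
    rcases k with (j | j) | (j | j)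
    · rfl
    · exact (h0 j).symm
    · rfl
    · simp [h0 j]

theorem isTotallyReal_ambient (hF2 : ∀ j, VanishesTo 2 (F j)) (hθ : Centered θ)
    (hinj : Function.Injective (diff θ))
    (hz : ∀ v ∈ LinearMap.range (diff θ), (∀ j, v (Sum.inl j) = 0) → v = 0) :
    IsTotallyReal (vanishingIdeal (ambientParam F θ)
      (centered_ambientParam (centered_of_vanishesTo_two hF2) hθ)) := by
  intro v hv hiv
  rw [mem_realTangentSpace_ambient hF2 hθ hinj] at hv hiv
  -- The difference `i (v, conj v) - (iv, conj (iv)) = (0, 2i conj v)` has zero `z'`-part.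
  have h1 := hz _ (Submodule.sub_mem _ (Submodule.smul_mem _ Complex.I hv.2) hiv.2)
    (fun j => by simp)
  funext k
  rcases k with j | j
  · have h2 := congr_fun h1 (Sum.inr j)
    simp only [Pi.sub_apply, Pi.smul_apply, Sum.elim_inr, smul_eq_mul, map_mul, Complex.conj_I,
      Pi.zero_apply] at h2
    have h3 : (2 * Complex.I) * starRingEnd ℂ (v (Sum.inl j)) = 0 := by linear_combination h2
    simpa using h3
  · exact hv.1 j

end diff

/-- The coordinates `(z', F(z', w'))` of `π₁`. -/
def piOne (F : ι → MvPowerSeries (ι ⊕ ι) ℂ) : ι ⊕ ι → MvPowerSeries (ι ⊕ ι) ℂ :=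
  Sum.elim (fun j => X (Sum.inl j)) F

theorem centered_piOne (hF : Centered F) : Centered (piOne F) := by
  rintro (j | j)
  exacts [centered_X _, hF j]

theorem comp_ambientParam_hol (hF : Centered F) (hθ : Centered θ)
    (f : MvPowerSeries (ι ⊕ ι) ℂ) :
    comp (ambientParam F θ) (comp (fun a => X (Sum.inl a)) f) =
      comp (fun k => comp θ (piOne F k)) f := by
  have hX : Centered fun a : ι ⊕ ι =>
      (X (Sum.inl a) : MvPowerSeries ((ι ⊕ ι) ⊕ (ι ⊕ ι)) ℂ) := fun a => centered_X _
  rw [comp_comp hX (centered_ambientParam hF hθ)]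
  congr 1
  funext k
  exact comp_X (centered_ambientParam hF hθ) _

theorem holToReal_le_iff (hF : Centered F) (hθ : Centered θ) {K : Ideal (MvPowerSeries (ι ⊕ ι) ℂ)} :
    holToReal K ≤ vanishingIdeal (ambientParam F θ) (centered_ambientParam hF hθ) ↔
      K ≤ vanishingIdeal (fun k => comp θ (piOne F k))
        (Centered.comp (centered_piOne hF) hθ) := by
  rw [holToReal, Ideal.span_le, Set.image_subset_iff]
  refine forall_congr' fun f => forall_congr' fun _ => ?_
  rw [Set.mem_preimage, SetLike.mem_coe, mem_vanishingIdeal, mem_vanishingIdeal,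
    comp_ambientParam_hol hF hθ]

/-- Formal totally real submanifolds of `M` of dimension `p` are graphs over the
`z'`-space. -/
theorem exists_ambientParam (hF2 : ∀ j, VanishesTo 2 (F j))
    {J : Ideal (MvPowerSeries ((ι ⊕ ι) ⊕ (ι ⊕ ι)) ℂ)}
    (hJ : IsRealFormalSubmanifold J (Fintype.card ι)) (htr : IsTotallyReal J)
    (hM : idealM F ≤ J) :
    ∃ (θ : ι ⊕ ι → MvPowerSeries ι ℂ) (hθ : Centered θ), (∀ j, θ (Sum.inl j) = X j) ∧
      J = vanishingIdeal (ambientParam F θ)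
        (centered_ambientParam (centered_of_vanishesTo_two hF2) hθ) ∧
      ∀ f ∈ vanishingIdeal θ hθ, conjugate f ∈ vanishingIdeal θ hθ := by
  classical
  have hF := centered_of_vanishesTo_two hF2
  obtain ⟨k, r, hk, hreal, hr0, hli, hspan⟩ := hJ
  have hconj : ∀ f ∈ J, conjugate f ∈ J := by
    intro f hf
    rw [hspan] at hf ⊢
    induction hf using Submodule.span_induction with
    | mem x hx =>
      obtain ⟨i, rfl⟩ := hx
      rw [hreal]
      exact Ideal.subset_span ⟨i, rfl⟩
    | zero => rw [conjugate_zero]; exact Ideal.zero_mem _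
    | add x y _ _ hx hy => rw [conjugate_add]; exact Ideal.add_mem _ hx hy
    | smul a x _ hx => rw [smul_eq_mul, conjugate_mul]; exact Ideal.mul_mem_left _ _ hx
  rw [idealM_le_iff] at hM
  have htanM : ∀ v ∈ tangentSpace J, ∀ j, v (Sum.inl (Sum.inr j)) = 0 := by
    intro v hv j
    have h1 := hv _ (hM.1 j)
    have h2 : linearPart (comp (baseCoords ι) (F j)) = 0 :=
      linearPart_eq_zero ((hF2 j).comp centered_baseCoords)
    rw [linearPart_sub, h2, sub_zero] at h1
    have h3 := congr_fun (diff_X v) (Sum.inl (Sum.inr j))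
    rw [diff_apply] at h3
    rw [← h3, h1]
  have htanM' : ∀ v ∈ tangentSpace J, ∀ j, v (Sum.inr (Sum.inr j)) = 0 := by
    intro v hv j
    simpa [conjVec] using htanM _ (conjVec_mem_tangentSpace hconj hv) j
  set π : ι → MvPowerSeries ((ι ⊕ ι) ⊕ (ι ⊕ ι)) ℂ := fun j => X (Sum.inl (Sum.inl j)) with hπdef
  have hπ : Centered π := fun j => centered_X _
  have hinj : Function.Injective (diff (Sum.elim π r)) := by
    refine (injective_iff_map_eq_zero _).2 fun v hv => ?_
    have hz : ∀ j, v (Sum.inl (Sum.inl j)) = 0 := fun j =>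
      (congr_fun (diff_X v) (Sum.inl (Sum.inl j))).symm.trans (congr_fun hv (Sum.inl j))
    have hvT : v ∈ tangentSpace J := by
      rw [hspan]
      exact mem_tangentSpace_span hr0 fun i => congr_fun hv (Sum.inr i)
    have hcT := conjVec_mem_tangentSpace hconj hvT
    -- If `v` has only a `w'`-component `w`, then `conj v + v` and `i (conj v - v)` are fixed by
    -- conjugation. They make `conj w` and `i conj w` real tangent vectors, contrary to total
    -- reality unless `w = 0`.
    have h1 : (Sum.elim (fun j => starRingEnd ℂ (v (Sum.inr (Sum.inl j)))) 0 : ι ⊕ ι → ℂ) ∈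
        realTangentSpace J := by
      change _ ∈ tangentSpace J
      convert Submodule.add_mem _ hcT hvT using 1
      funext c
      rcases c with (j | j) | (j | j) <;>
        simp [conjVec, hz, htanM v hvT, htanM' v hvT]
    have h2 : Complex.I •
        (Sum.elim (fun j => starRingEnd ℂ (v (Sum.inr (Sum.inl j)))) 0 : ι ⊕ ι → ℂ) ∈
        realTangentSpace J := by
      change _ ∈ tangentSpace J
      convert Submodule.smul_mem _ Complex.I (Submodule.sub_mem _ hcT hvT) using 1
      funext c
      rcases c with (j | j) | (j | j) <;>
        simp [conjVec, hz, htanM v hvT, htanM' v hvT]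
    have h3 := htr _ h1 h2
    funext c
    rcases c with (j | j) | (j | j)
    · exact hz j
    · exact htanM v hvT j
    · have := congr_fun h3 (Sum.inl j)
      simpa using this
    · exact htanM' v hvT j
  have hbij : Function.Bijective (diff (Sum.elim π r)) := by
    refine ⟨hinj, ?_⟩
    rwa [← LinearMap.injective_iff_surjective_of_finrank_eq_finrank]
    simp only [Module.finrank_fintype_fun_eq_card, Fintype.card_sum, Fintype.card_fin] at hk ⊢
    omega
  obtain ⟨Θ, hΘ, h1, h2⟩ := exists_parametrization hπ hr0 hbij
  rw [← hspan] at h2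
  have hθ : Centered fun c => comp Θ (baseCoords ι c) := Centered.comp centered_baseCoords hΘ
  have hb : ∀ f, comp Θ (comp (baseCoords ι) f) = comp (fun c => comp Θ (baseCoords ι c)) f :=
    fun f => comp_comp centered_baseCoords hΘ f
  -- The equations of `M` lie in `J`, so the `z''`- and `w''`-components are determined by the `(z',
  -- w')`-components.
  have hΘe : Θ = ambientParam F fun c => comp Θ (baseCoords ι c) := by
    funext c
    rcases c with (j | j) | (j | j)
    · exact (comp_X hΘ _).symm.trans (comp_X hθ (Sum.inl j)).symm
    · have := hM.1 j
      rw [h2, mem_vanishingIdeal, comp_sub hΘ, comp_X hΘ, hb, sub_eq_zero] at this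
      exact this
    · exact (comp_X hΘ _).symm.trans (comp_X hθ (Sum.inr j)).symm
    · have := hM.2 j
      rw [h2, mem_vanishingIdeal, comp_sub hΘ, comp_X hΘ, hb, sub_eq_zero] at this
      exact this
  refine ⟨_, hθ, h1, ?_, fun f hf => ?_⟩
  · rw [h2]
    congr 1
  · have h3 : comp (baseCoords ι) f ∈ J := by
      rw [h2, mem_vanishingIdeal, hb]
      exact mem_vanishingIdeal.1 hf
    have h4 := hconj _ h3
    rw [conjugate_comp centered_baseCoords, funext conjugate_baseCoords, h2, mem_vanishingIdeal,
      hb] at h4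
    exact mem_vanishingIdeal.2 h4

/-- The restrictions of `F` to the complexifications of two submanifolds of `M` which are graphs
and lie in a common complex submanifold are equal. -/
theorem comp_eq_of_le (hF2 : ∀ j, VanishesTo 2 (F j)) {K : Ideal (MvPowerSeries (ι ⊕ ι) ℂ)}
    (hK : IsFormalSubmanifold K (Fintype.card ι)) {θ₁ θ₂ : ι ⊕ ι → MvPowerSeries ι ℂ}
    (h₁ : Centered θ₁) (h₂ : Centered θ₂) (hX₁ : ∀ j, θ₁ (Sum.inl j) = X j)
    (hX₂ : ∀ j, θ₂ (Sum.inl j) = X j)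
    (hle₁ : K ≤ vanishingIdeal (fun k => comp θ₁ (piOne F k))
      (Centered.comp (centered_piOne (centered_of_vanishesTo_two hF2)) h₁))
    (hle₂ : K ≤ vanishingIdeal (fun k => comp θ₂ (piOne F k))
      (Centered.comp (centered_piOne (centered_of_vanishesTo_two hF2)) h₂)) (j : ι) :
    comp θ₁ (F j) = comp θ₂ (F j) := by
  classical
  have hF := centered_of_vanishesTo_two hF2
  obtain ⟨k, r, hk, hr0, hli, rfl⟩ := hK
  have hfin : Module.finrank ℂ (LinearMap.ker (diff r)) = Fintype.card ι := by
    have := card_add_finrank_ker hli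
    rw [Fintype.card_fin] at this
    omega
  -- The tangent space of `K` contains that of the image of `π₁ ∘ θ₁`, which projects onto the
  -- `z'`-space; hence `K` is a graph `z'' = Θ(z')`, and `Θ` must be the restriction of `F` in both
  -- cases.
  have hsurj : ∀ z : ι → ℂ, ∃ v ∈ LinearMap.ker (diff r), ∀ i, v (Sum.inl i) = z i := by
    intro z
    refine ⟨diff (fun k => comp θ₁ (piOne F k)) z, ?_, fun i => ?_⟩
    · rw [LinearMap.mem_ker, ← diff_comp (Centered.comp (centered_piOne hF) h₁)]
      refine diff_eq_zero_iff.2 fun i => ?_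
      have : comp (fun k => comp θ₁ (piOne F k)) (r i) = 0 :=
        mem_vanishingIdeal.1 (hle₁ (Ideal.subset_span ⟨i, rfl⟩))
      rw [this, linearPart_zero]
      simp
    · have : comp θ₁ (piOne F (Sum.inl i)) = X i := (comp_X h₁ _).trans (hX₁ i)
      rw [diff_apply, this]
      exact congr_fun (diff_X z) i
  set π : ι → MvPowerSeries (ι ⊕ ι) ℂ := fun j => X (Sum.inl j) with hπdef
  have hπ : Centered π := fun j => centered_X _
  have hinj : Function.Injective (diff (Sum.elim π r)) := by
    refine (injective_iff_map_eq_zero _).2 fun v hv => ?_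
    refine eq_zero_of_inl_eq_zero hfin hsurj (funext fun i => congr_fun hv (Sum.inr i)) fun i => ?_
    exact (congr_fun (diff_X v) (Sum.inl i)).symm.trans (congr_fun hv (Sum.inl i))
  have hbij : Function.Bijective (diff (Sum.elim π r)) := by
    refine ⟨hinj, ?_⟩
    rwa [← LinearMap.injective_iff_surjective_of_finrank_eq_finrank]
    simp only [Module.finrank_fintype_fun_eq_card, Fintype.card_sum, Fintype.card_fin] at hk ⊢
    omega
  obtain ⟨Θ, hΘ, h1, h2⟩ := exists_parametrization hπ hr0 hbij
  have key : ∀ {θ : ι ⊕ ι → MvPowerSeries ι ℂ} (hθ : Centered θ), (∀ j, θ (Sum.inl j) = X j) →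
      Ideal.span (Set.range r) ≤ vanishingIdeal (fun k => comp θ (piOne F k))
        (Centered.comp (centered_piOne hF) hθ) → comp θ (F j) = Θ (Sum.inr j) := by
    intro θ hθ hX hle
    rw [h2] at hle
    have h3 := eq_comp_of_vanishingIdeal_le hπ h1 hle (Sum.inr j)
    have h4 : (fun a => comp (fun k => comp θ (piOne F k)) (π a)) = X := by
      funext a
      rw [hπdef, comp_X (Centered.comp (centered_piOne hF) hθ)]
      exact (comp_X hθ _).trans (hX a)
    rw [h4, comp_id] at h3
    exact h3
  rw [key h₁ hX₁ hle₁, key h₂ hX₂ hle₂]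

end ambient

/-! ### Reversibility -/

theorem conjVec_conjVec (v : α ⊕ α → ℂ) : conjVec (conjVec v) = v := by
  funext k; simp [conjVec]

theorem conjVec_smul (c : ℂ) (v : α ⊕ α → ℂ) :
    conjVec (c • v) = starRingEnd ℂ c • conjVec v := by
  funext k; simp [conjVec]

theorem conjVec_add (v w : α ⊕ α → ℂ) : conjVec (v + w) = conjVec v + conjVec w := by
  funext k; simp [conjVec]

theorem conjVec_zero : conjVec (0 : α ⊕ α → ℂ) = 0 := by
  funext k; simp [conjVec]

theorem conjVec_sum {κ : Type*} (s : Finset κ) (f : κ → α ⊕ α → ℂ) :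
    conjVec (∑ i ∈ s, f i) = ∑ i ∈ s, conjVec (f i) := by
  funext k; simp [conjVec, Finset.sum_apply]

theorem diff_conjParam [Fintype γ] (θ : α ⊕ α → MvPowerSeries γ ℂ) (v : γ → ℂ) :
    diff (conjParam θ) v = conjVec (diff θ fun a => starRingEnd ℂ (v a)) := by
  funext k
  simp only [conjVec, diff_apply, map_sum, map_mul, Complex.conj_conj]
  rfl

section reversible

variable {ι : Type} [Fintype ι] {q : ι → MvPowerSeries (ι ⊕ ι) ℂ}
  {τ : ι ⊕ ι → MvPowerSeries (ι ⊕ ι) ℂ}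

theorem centered_rhoConj (hτ : Centered τ) : Centered (rhoConj τ) := fun k => by
  rw [rhoConj, constantCoeff_conjugate, hτ, map_zero]

theorem centered_sigma (hτ : Centered τ) : Centered (sigma τ) :=
  Centered.comp hτ (centered_rhoConj hτ)

theorem comp_rhoConj (hτ : Centered τ) (f : MvPowerSeries (ι ⊕ ι) ℂ) :
    comp (rhoConj τ) f = conjugate (comp τ (conjugate f)) := by
  rw [conjugate_comp hτ, conjugate_conjugate]
  rfl

theorem comp_sigma (hτ : Centered τ) (f : MvPowerSeries (ι ⊕ ι) ℂ) :
    comp (sigma τ) f = comp (rhoConj τ) (comp τ f) :=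
  (comp_comp hτ (centered_rhoConj hτ) f).symm

theorem diff_rhoConj (τ : ι ⊕ ι → MvPowerSeries (ι ⊕ ι) ℂ) (v : ι ⊕ ι → ℂ) :
    diff (rhoConj τ) v = conjVec (diff τ (conjVec v)) := by
  funext k
  simp only [conjVec, diff_apply, map_sum, map_mul, Complex.conj_conj]
  rw [← (Equiv.sumComm ι ι).sum_comp]
  refine Finset.sum_congr rfl fun j _ => ?_
  rw [rhoConj, linearPart_conjugate]
  simp

theorem diff_sigma (hτ : Centered τ) (v : ι ⊕ ι → ℂ) :
    diff (sigma τ) v = diff τ (conjVec (diff τ (conjVec v))) := by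
  unfold sigma
  rw [diff_comp (centered_rhoConj hτ), diff_rhoConj]

theorem IsReflection.comp_comp_self (hq : IsTransverse q) (h : IsReflection q τ)
    (f : MvPowerSeries (ι ⊕ ι) ℂ) : CRSing.comp τ (CRSing.comp τ f) = f := by
  rw [comp_comp h.centered h.centered, funext (h.involutive hq), comp_id]

theorem IsReflection.comp_rhoConj_self (hq : IsTransverse q) (h : IsReflection q τ)
    (f : MvPowerSeries (ι ⊕ ι) ℂ) :
    CRSing.comp (rhoConj τ) (CRSing.comp (rhoConj τ) f) = f := by
  rw [comp_rhoConj h.centered, comp_rhoConj h.centered, conjugate_conjugate,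
    h.comp_comp_self hq, conjugate_conjugate]

/-- The linear map `Dτ₁` conjugates `Dσ` to its inverse. -/
theorem IsReflection.diff_sigma_diff (hq : IsTransverse q) (h : IsReflection q τ) {μ : ℂ}
    (hμ : μ ≠ 0) {v : ι ⊕ ι → ℂ} (hv : diff (sigma τ) v = μ • v) :
    diff (sigma τ) (diff τ v) = μ⁻¹ • diff τ v := by
  -- That is, `Dτ₂ v = μ Dτ₁ v`, from `Dτ₁ Dτ₂ v = μ v` and `Dτ₁² = 1`.
  have h1 : conjVec (diff τ (conjVec v)) = μ • diff τ v := by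
    rw [diff_sigma h.centered] at hv
    rw [← h.diff_diff hq (conjVec _), hv, map_smul]
  have h2 : conjVec (diff τ (conjVec (diff τ v))) = μ⁻¹ • v := by
    have : diff τ v = μ⁻¹ • conjVec (diff τ (conjVec v)) := by
      rw [h1, smul_smul, inv_mul_cancel₀ hμ, one_smul]
    rw [this, conjVec_smul, conjVec_conjVec, map_smul, h.diff_diff hq, conjVec_smul,
      Complex.conj_conj, conjVec_conjVec]
  rw [diff_sigma h.centered, h2, map_smul]

/-- The involution `ρ` conjugates `Dσ` to its inverse. -/
theorem IsReflection.diff_sigma_conjVec (hq : IsTransverse q) (h : IsReflection q τ) {μ : ℂ}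
    (hμ : μ ≠ 0) {v : ι ⊕ ι → ℂ} (hv : diff (sigma τ) v = μ • v) :
    diff (sigma τ) (conjVec v) = (starRingEnd ℂ μ)⁻¹ • conjVec v := by
  have h1 := h.diff_sigma_diff hq hμ hv
  rw [diff_sigma h.centered] at h1
  have h2 : conjVec (diff τ (conjVec (diff τ v))) = μ⁻¹ • v := by
    rw [← h.diff_diff hq (conjVec _), h1, map_smul, h.diff_diff hq]
  rw [diff_sigma h.centered, conjVec_conjVec]
  have h3 : diff τ (conjVec (diff τ v)) = conjVec (μ⁻¹ • v) := by rw [← h2, conjVec_conjVec]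
  rw [h3, conjVec_smul, map_inv₀]

end reversible

section eigen

variable {ι : Type} [Fintype ι] [DecidableEq ι] {q : ι → MvPowerSeries (ι ⊕ ι) ℂ}
  {τ : ι ⊕ ι → MvPowerSeries (ι ⊕ ι) ℂ} {ν : ι → ℂ} {T : (ι ⊕ ι → ℂ) ≃ₗ[ℂ] (ι ⊕ ι → ℂ)}

/-- The convention `0⁻¹ = 0` would make `ν_j = 0` coincide with its inverse. -/
theorem ne_zero_of_injective_elim_inv (hν : Function.Injective (Sum.elim ν fun j => (ν j)⁻¹))
    (j : ι) : ν j ≠ 0 := fun h0 => by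
  have := @hν (Sum.inl j) (Sum.inr j) (by simp [h0])
  simp at this

theorem IsDiagonalizedBy.eigenvector {σ : ι ⊕ ι → MvPowerSeries (ι ⊕ ι) ℂ}
    (hT : IsDiagonalizedBy σ ν (fun j => (ν j)⁻¹) T) (j : ι) :
    diff σ (T.symm (Pi.single (Sum.inl j) 1)) = ν j • T.symm (Pi.single (Sum.inl j) 1) := by
  refine T.injective (funext fun c => ?_)
  rw [map_smul, Pi.smul_apply, smul_eq_mul]
  rcases c with k | k
  · rw [hT.inl, T.apply_symm_apply]
    rcases eq_or_ne k j with rfl | h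
    · rfl
    · simp [h]
  · rw [hT.inr, T.apply_symm_apply]
    simp

theorem sum_eigenvectors {v : ι ⊕ ι → ℂ} (hv : ∀ k, T v (Sum.inr k) = 0) :
    v = ∑ j, T v (Sum.inl j) • T.symm (Pi.single (Sum.inl j) 1) := by
  refine T.injective (funext fun c => ?_)
  simp only [map_sum, map_smul, T.apply_symm_apply, Finset.sum_apply, Pi.smul_apply, smul_eq_mul,
    Pi.single_apply]
  rcases c with k | k
  · simp
  · simp [hv]

/-- `Dτ₁` sends `ν_j`-eigenvectors to `ν_j⁻¹`-eigenvectors, which have no `x`-component since the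
eigenvalues are distinct. This makes the two members of the pair transversal. -/
theorem IsReflection.apply_diff_inl (hq : IsTransverse q) (h : IsReflection q τ)
    (hν : Function.Injective (Sum.elim ν fun j => (ν j)⁻¹))
    (hT : IsDiagonalizedBy (sigma τ) ν (fun j => (ν j)⁻¹) T) {v : ι ⊕ ι → ℂ}
    (hv : ∀ k, T v (Sum.inr k) = 0) (k : ι) : T (diff τ v) (Sum.inl k) = 0 := by
  rw [sum_eigenvectors hv]
  simp only [map_sum, map_smul, Finset.sum_apply, Pi.smul_apply]
  refine Finset.sum_eq_zero fun j _ => smul_eq_zero_of_right _ ?_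
  have h1 := h.diff_sigma_diff hq (ne_zero_of_injective_elim_inv hν j) (hT.eigenvector j)
  have h2 := hT.inl (diff τ (T.symm (Pi.single (Sum.inl j) 1))) k
  rw [h1, map_smul, Pi.smul_apply, smul_eq_mul] at h2
  by_contra h0
  have := @hν (Sum.inl k) (Sum.inr j) (mul_right_cancel₀ h0 h2).symm
  simp at this

/-- `ρ` sends a `ν_j`-eigenvector to one of eigenvalue `conj(ν_j)⁻¹ = ν_{s j}`, so it preserves `{y
= 0}`. -/
theorem IsReflection.apply_conjVec_inr (hq : IsTransverse q) (h : IsReflection q τ)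
    (hν : Function.Injective (Sum.elim ν fun j => (ν j)⁻¹))
    (hT : IsDiagonalizedBy (sigma τ) ν (fun j => (ν j)⁻¹) T)
    {s : ι → ι} (hs : ∀ j, (starRingEnd ℂ (ν j))⁻¹ = ν (s j)) {v : ι ⊕ ι → ℂ}
    (hv : ∀ k, T v (Sum.inr k) = 0) (k : ι) : T (conjVec v) (Sum.inr k) = 0 := by
  have hsum : conjVec v = ∑ j, starRingEnd ℂ (T v (Sum.inl j)) •
      conjVec (T.symm (Pi.single (Sum.inl j) 1)) := by
    conv_lhs => rw [sum_eigenvectors hv]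
    rw [conjVec_sum]
    simp only [conjVec_smul]
  rw [hsum]
  simp only [map_sum, map_smul, Finset.sum_apply, Pi.smul_apply]
  refine Finset.sum_eq_zero fun j _ => smul_eq_zero_of_right _ ?_
  have h1 := h.diff_sigma_conjVec hq (ne_zero_of_injective_elim_inv hν j) (hT.eigenvector j)
  have h2 := hT.inr (conjVec (T.symm (Pi.single (Sum.inl j) 1))) k
  rw [h1, hs, map_smul, Pi.smul_apply, smul_eq_mul] at h2
  by_contra h0
  have := @hν (Sum.inl (s j)) (Sum.inr k) (mul_right_cancel₀ h0 h2)
  simp at this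

end eigen

/-! ### Pairs of asymptotic submanifolds -/

section pairs

variable {ι : Type} [Fintype ι] [DecidableEq ι] {q : ι → MvPowerSeries (ι ⊕ ι) ℂ}
  {τ : ι ⊕ ι → MvPowerSeries (ι ⊕ ι) ℂ}

theorem IsTransverse.vanishesTo_sq (hq : IsTransverse q) (j : ι) : VanishesTo 2 (q j ^ 2) := by
  rw [pow_two]
  exact VanishesTo.mul (d := 1) (e := 1) (vanishesTo_one_iff.2 (hq.centered j))
    (vanishesTo_one_iff.2 (hq.centered j))

theorem IsTransverse.centered_sq (hq : IsTransverse q) : Centered fun j => q j ^ 2 :=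
  centered_of_vanishesTo_two hq.vanishesTo_sq

theorem IsReflection.comp_piOne (h : IsReflection q τ) (k : ι ⊕ ι) :
    CRSing.comp τ (piOne (fun j => q j ^ 2) k) = piOne (fun j => q j ^ 2) k := by
  rcases k with j | j
  · exact (comp_X h.centered _).trans (h.inl j)
  · change CRSing.comp τ (q j ^ 2) = q j ^ 2
    rw [comp_pow h.centered, h.comp, neg_sq]

/-- A conjugation-invariant graph over the `z'`-space and its image under the reflection are the
complexifications of a pair of asymptotic submanifolds. -/
theorem isAsymptoticPair (hq : IsTransverse q) (h : IsReflection q τ)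
    {θ : ι ⊕ ι → MvPowerSeries ι ℂ} (hθ : Centered θ) (hinj : Function.Injective (diff θ))
    (hconj : ∀ f ∈ vanishingIdeal θ hθ, conjugate f ∈ vanishingIdeal θ hθ)
    (hinv : ∀ f ∈ vanishingIdeal θ hθ, comp (sigma τ) f ∈ vanishingIdeal θ hθ)
    (hdisj : ∀ v ∈ LinearMap.range (diff θ), diff τ v ∈ LinearMap.range (diff θ) → v = 0) :
    IsAsymptoticPair (fun j => q j ^ 2)
      (vanishingIdeal (ambientParam (fun j => q j ^ 2) θ)
        (centered_ambientParam hq.centered_sq hθ))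
      (vanishingIdeal (ambientParam (fun j => q j ^ 2) fun k => comp θ (τ k))
        (centered_ambientParam hq.centered_sq (Centered.comp h.centered hθ))) := by
  have hF2 := hq.vanishesTo_sq
  have hθ₂ : Centered fun k => comp θ (τ k) := Centered.comp h.centered hθ
  have hd : ∀ u, diff (fun k => comp θ (τ k)) u = diff τ (diff θ u) := diff_comp hθ τ
  have hinj₂ : Function.Injective (diff fun k => comp θ (τ k)) := fun u u' hu => hinj (by
    rw [hd, hd] at hu
    rw [← h.diff_diff hq (diff θ u), hu, h.diff_diff hq])
  -- A tangent vector with `z' = 0` is negated by `Dτ`, hence is tangent to `H` and to `τ₁H`.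
  have hz : ∀ v ∈ LinearMap.range (diff θ), (∀ j, v (Sum.inl j) = 0) → v = 0 := by
    intro v hv hv0
    refine hdisj v hv ?_
    rw [h.diff_eq_neg hq hv0]
    exact Submodule.neg_mem _ hv
  have hz₂ : ∀ v ∈ LinearMap.range (diff fun k => comp θ (τ k)),
      (∀ j, v (Sum.inl j) = 0) → v = 0 := by
    rintro _ ⟨u, rfl⟩ hv0
    have h0 : diff θ u = 0 := by
      refine hz _ ⟨u, rfl⟩ fun j => ?_
      rw [← diff_inl_of_eq_X h.inl (diff θ u) j, ← hd, hv0]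
    rw [hd, h0, map_zero]
  have hmem : ∀ f, f ∈ vanishingIdeal _ hθ₂ ↔ comp τ f ∈ vanishingIdeal θ hθ := fun f => by
    rw [mem_vanishingIdeal, mem_vanishingIdeal, comp_comp h.centered hθ]
  have hconj₂ : ∀ f ∈ vanishingIdeal _ hθ₂, conjugate f ∈ vanishingIdeal _ hθ₂ := by
    intro f hf
    rw [hmem] at hf ⊢
    -- `(f ∘ τ₁) ∘ σ = f ∘ τ₂` because `τ₁² = 1`, and its conjugate is `conj f ∘ τ₁`.
    have h1 := hconj _ (hinv _ hf)
    rwa [comp_sigma h.centered, h.comp_comp_self hq, comp_rhoConj h.centered,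
      conjugate_conjugate] at h1
  refine ⟨isRealFormalSubmanifold_vanishingIdeal _ (diff_ambientParam_injective hF2 hθ hinj)
      (conjugate_mem_ambient hq.centered_sq hθ hconj),
    isRealFormalSubmanifold_vanishingIdeal _ (diff_ambientParam_injective hF2 hθ₂ hinj₂)
      (conjugate_mem_ambient hq.centered_sq hθ₂ hconj₂),
    isTotallyReal_ambient hF2 hθ hinj hz, isTotallyReal_ambient hF2 hθ₂ hinj₂ hz₂,
    idealM_le_vanishingIdeal hq.centered_sq hθ, idealM_le_vanishingIdeal hq.centered_sq hθ₂,
    ?_, ?_⟩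
  · refine Set.eq_singleton_iff_unique_mem.2 ⟨?_, ?_⟩
    · constructor
      · rw [mem_realTangentSpace_ambient hF2 hθ hinj]
        refine ⟨fun j => rfl, ?_⟩
        convert Submodule.zero_mem _
        funext k; rcases k with j | j <;> simp
      · rw [mem_realTangentSpace_ambient hF2 hθ₂ hinj₂]
        refine ⟨fun j => rfl, ?_⟩
        convert Submodule.zero_mem _
        funext k; rcases k with j | j <;> simp
    · rintro v ⟨h1, h2⟩
      rw [mem_realTangentSpace_ambient hF2 hθ hinj] at h1
      rw [mem_realTangentSpace_ambient hF2 hθ₂ hinj₂] at h2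
      have h3 := hdisj _ h1.2 (by
        obtain ⟨u, hu⟩ := h2.2
        rw [← hu, hd, h.diff_diff hq]
        exact ⟨u, rfl⟩)
      funext k
      rcases k with j | j
      · exact congr_fun h3 (Sum.inl j)
      · exact h1.1 j
  · have hP : Centered fun k => comp θ (piOne (fun j => q j ^ 2) k) :=
      Centered.comp (centered_piOne hq.centered_sq) hθ
    have hdP : Function.Injective (diff fun k => comp θ (piOne (fun j => q j ^ 2) k)) := by
      refine (injective_iff_map_eq_zero _).2 fun u hu => ?_
      refine (injective_iff_map_eq_zero _).1 hinj u (hz _ ⟨u, rfl⟩ fun j => ?_)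
      have h1 := congr_fun hu (Sum.inl j)
      rw [diff_comp hθ] at h1
      exact (congr_fun (diff_X (diff θ u)) (Sum.inl j)).symm.trans h1
    -- `K` is the image of `H` under `π₁`; it is also that of `τ₁H`, because `π₁ ∘ τ₁ = π₁`.
    refine ⟨vanishingIdeal _ hP, isFormalSubmanifold_vanishingIdeal hP hdP,
      (holToReal_le_iff hq.centered_sq hθ).2 le_rfl,
      (holToReal_le_iff hq.centered_sq hθ₂).2 (le_of_eq ?_)⟩
    have : (fun k => comp (fun k => comp θ (τ k)) (piOne (fun j => q j ^ 2) k)) =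
        fun k => comp θ (piOne (fun j => q j ^ 2) k) := by
      funext k
      rw [← comp_comp h.centered hθ, h.comp_piOne]
    congr 1
    exact this.symm

/-- The complexifications of the members of a pair of asymptotic submanifolds are exchanged by the
reflection and invariant under `σ`. -/
theorem IsAsymptoticPair.exists_param (hq : IsTransverse q) (h : IsReflection q τ)
    {J₁ J₂ : Ideal (MvPowerSeries ((ι ⊕ ι) ⊕ (ι ⊕ ι)) ℂ)}
    (hJ : IsAsymptoticPair (fun j => q j ^ 2) J₁ J₂) :
    ∃ (θ : ι ⊕ ι → MvPowerSeries ι ℂ) (hθ : Centered θ), Function.Injective (diff θ) ∧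
      J₁ = vanishingIdeal (ambientParam (fun j => q j ^ 2) θ)
        (centered_ambientParam hq.centered_sq hθ) ∧
      J₂ = vanishingIdeal (ambientParam (fun j => q j ^ 2) fun k => comp θ (τ k))
        (centered_ambientParam hq.centered_sq (Centered.comp h.centered hθ)) ∧
      ∀ f ∈ vanishingIdeal θ hθ, comp (sigma τ) f ∈ vanishingIdeal θ hθ := by
  obtain ⟨hR₁, hR₂, hT₁, hT₂, hM₁, hM₂, hdisj, K, hK, hK₁, hK₂⟩ := hJ
  have hF2 := hq.vanishesTo_sq
  obtain ⟨θ₁, h₁, hX₁, rfl, hc₁⟩ := exists_ambientParam hF2 hR₁ hT₁ hM₁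
  obtain ⟨θ₂, h₂, hX₂, rfl, hc₂⟩ := exists_ambientParam hF2 hR₂ hT₂ hM₂
  have hdX : ∀ {θ : ι ⊕ ι → MvPowerSeries ι ℂ}, (∀ j, θ (Sum.inl j) = X j) → ∀ u j,
      diff θ u (Sum.inl j) = u j := fun hX u j => by
    rw [diff_apply, hX]
    exact congr_fun (diff_X u) j
  have hinj : ∀ {θ : ι ⊕ ι → MvPowerSeries ι ℂ}, (∀ j, θ (Sum.inl j) = X j) →
      Function.Injective (diff θ) := fun hX u u' hu => funext fun j => by
    rw [← hdX hX u, hu, hdX hX]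
  rw [holToReal_le_iff hq.centered_sq h₁] at hK₁
  rw [holToReal_le_iff hq.centered_sq h₂] at hK₂
  have hsq := fun j => comp_eq_of_le hF2 hK h₁ h₂ hX₁ hX₂ hK₁ hK₂ j
  have hsign : ∀ j, comp θ₂ (q j) = comp θ₁ (q j) ∨ comp θ₂ (q j) = -comp θ₁ (q j) := fun j => by
    have := hsq j
    rwa [comp_pow h₁, comp_pow h₂, eq_comm, sq_eq_sq_iff_eq_or_eq_neg] at this
  have hneg : ∀ j, comp θ₂ (q j) = -comp θ₁ (q j) := by
    intro j
    refine (hsign j).resolve_left fun hj => ?_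
    -- A plus sign at `j` kills the `j`-th component of `D`, so `D` has a nonzero kernel vector `u`,
    -- with `Dθ₁ u = Dθ₂ u` a common tangent vector. Both tangent spaces are `ρ`-invariant, so its
    -- real and imaginary parts contradict transversality.
    set D : (ι → ℂ) →ₗ[ℂ] (ι → ℂ) := diff q ∘ₗ (diff θ₂ - diff θ₁) with hD
    have hDj : ∀ u, D u j = 0 := fun u => by
      rw [hD, LinearMap.comp_apply, LinearMap.sub_apply, map_sub, Pi.sub_apply, ← diff_comp h₂,
        ← diff_comp h₁, diff_apply, diff_apply, hj, sub_self]
    have hDinj : ¬ Function.Injective D := fun hi => by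
      obtain ⟨u, hu⟩ := LinearMap.injective_iff_surjective.1 hi (Pi.single j 1)
      have := hDj u
      rw [hu] at this
      simp at this
    rw [injective_iff_map_eq_zero] at hDinj
    push Not at hDinj
    obtain ⟨u, hu, hu0⟩ := hDinj
    have heq : diff θ₂ u = diff θ₁ u := by
      refine sub_eq_zero.1 (hq.bijective.1 ?_)
      rw [map_zero]
      funext c
      rcases c with i | i
      · rw [diff_squareCoords_inl, Pi.sub_apply, hdX hX₂, hdX hX₁, sub_self, Pi.zero_apply]
      · exact congr_fun hu i
    have hr₁ : conjVec (diff θ₁ u) ∈ LinearMap.range (diff θ₁) := by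
      rw [← tangentSpace_vanishingIdeal h₁ (hinj hX₁)]
      refine conjVec_mem_tangentSpace hc₁ ?_
      rw [tangentSpace_vanishingIdeal h₁ (hinj hX₁)]
      exact ⟨u, rfl⟩
    have hr₂ : conjVec (diff θ₁ u) ∈ LinearMap.range (diff θ₂) := by
      rw [← heq, ← tangentSpace_vanishingIdeal h₂ (hinj hX₂)]
      refine conjVec_mem_tangentSpace hc₂ ?_
      rw [tangentSpace_vanishingIdeal h₂ (hinj hX₂)]
      exact ⟨u, rfl⟩
    have hreal : ∀ w : ι ⊕ ι → ℂ, w ∈ LinearMap.range (diff θ₁) → w ∈ LinearMap.range (diff θ₂) →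
        conjVec w = w → ∀ j, w (Sum.inl j) = 0 := by
      intro w hw₁ hw₂ hw j
      have he : (Sum.elim (fun j => w (Sum.inl j)) (fun j => starRingEnd ℂ (w (Sum.inl j))) :
          ι ⊕ ι → ℂ) = w := by
        conv_rhs => rw [← hw]
        funext c
        rcases c with i | i
        · exact congr_fun hw.symm (Sum.inl i)
        · rfl
      have h0 : (Sum.elim (fun j => w (Sum.inl j)) 0 : ι ⊕ ι → ℂ) ∈ ({0} : Set (ι ⊕ ι → ℂ)) := by
        rw [← hdisj]
        exact ⟨(mem_realTangentSpace_ambient hF2 h₁ (hinj hX₁)).2 ⟨fun j => rfl, by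
            simpa only [Sum.elim_inl, he] using hw₁⟩,
          (mem_realTangentSpace_ambient hF2 h₂ (hinj hX₂)).2 ⟨fun j => rfl, by
            simpa only [Sum.elim_inl, he] using hw₂⟩⟩
      exact congr_fun (Set.mem_singleton_iff.1 h0) (Sum.inl j)
    have hu₁ : diff θ₁ u ∈ LinearMap.range (diff θ₁) := ⟨u, rfl⟩
    have hu₂ : diff θ₁ u ∈ LinearMap.range (diff θ₂) := ⟨u, heq⟩
    refine hu0 (funext fun i => ?_)
    have e1 := hreal (diff θ₁ u + conjVec (diff θ₁ u)) (Submodule.add_mem _ hu₁ hr₁)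
      (Submodule.add_mem _ hu₂ hr₂) (by rw [conjVec_add, conjVec_conjVec, add_comm]) i
    have e2 := hreal (Complex.I • diff θ₁ u + conjVec (Complex.I • diff θ₁ u))
      (Submodule.add_mem _ (Submodule.smul_mem _ _ hu₁)
        (by rw [conjVec_smul]; exact Submodule.smul_mem _ _ hr₁))
      (Submodule.add_mem _ (Submodule.smul_mem _ _ hu₂)
        (by rw [conjVec_smul]; exact Submodule.smul_mem _ _ hr₂))
      (by rw [conjVec_add, conjVec_conjVec, add_comm]) i
    rw [conjVec_smul, Complex.conj_I] at e2
    simp only [Pi.add_apply, Pi.smul_apply, smul_eq_mul, hdX hX₁] at e1 e2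
    have e3 : 2 * Complex.I * u i = 0 := by linear_combination Complex.I * e1 + e2
    simpa using e3
  have hθ₂ : θ₂ = fun k => comp θ₁ (τ k) := by
    refine hq.eq_of_comp_eq h₂ (Centered.comp h.centered h₁) (fun j => ?_) fun j => ?_
    · rw [h.inl, comp_X h₁, hX₁, hX₂]
    · rw [hneg, ← comp_comp h.centered h₁, h.comp, comp_neg h₁]
  subst hθ₂
  have hmem : ∀ f, f ∈ vanishingIdeal _ h₂ ↔ comp τ f ∈ vanishingIdeal θ₁ h₁ := fun f => by
    rw [mem_vanishingIdeal, mem_vanishingIdeal, comp_comp h.centered h₁]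
  refine ⟨θ₁, h₁, hinj hX₁, rfl, rfl, fun f hf => ?_⟩
  rw [comp_sigma h.centered, comp_rhoConj h.centered]
  -- The four factors of `σ = τ₁ρτ₁ρ` are absorbed one by one: `ρ` preserves both complexifications
  -- and `τ₁` exchanges them.
  refine hc₁ _ ((hmem _).1 (hc₂ _ ((hmem _).2 ?_)))
  rwa [h.comp_comp_self hq]

/-- The main theorem for the equations `z'' = q (z', z̄')²`. -/
theorem exists_unique_asymptoticPair (hq : IsTransverse q) (h : IsReflection q τ) {ν : ι → ℂ}
    (hν : Function.Injective (Sum.elim ν fun j => (ν j)⁻¹))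
    {T : (ι ⊕ ι → ℂ) ≃ₗ[ℂ] (ι ⊕ ι → ℂ)}
    (hT : IsDiagonalizedBy (sigma τ) ν (fun j => (ν j)⁻¹) T)
    {s : ι → ι} (hs : ∀ j, (starRingEnd ℂ (ν j))⁻¹ = ν (s j))
    (hres : ∀ (k : ι) (n : ι →₀ ℕ), 1 < n.degree → (n.prod fun a i => ν a ^ i) ≠ (ν k)⁻¹) :
    ∃ K₁ K₂, IsAsymptoticPair (fun j => q j ^ 2) K₁ K₂ ∧
      IsFormalSubmanifold (complexification (fun j => q j ^ 2) K₁) (Fintype.card ι) ∧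
      IsImage (sigma τ) (complexification (fun j => q j ^ 2) K₁)
        (complexification (fun j => q j ^ 2) K₁) ∧
      (tangentSpace (complexification (fun j => q j ^ 2) K₁) : Set (ι ⊕ ι → ℂ)) =
        {v | ∀ j, T v (Sum.inr j) = 0} ∧
      IsImage τ (complexification (fun j => q j ^ 2) K₁)
        (complexification (fun j => q j ^ 2) K₂) ∧
      ∀ J₁ J₂, IsAsymptoticPair (fun j => q j ^ 2) J₁ J₂ →
        (tangentSpace (complexification (fun j => q j ^ 2) J₁) : Set (ι ⊕ ι → ℂ)) =
          {v | ∀ j, T v (Sum.inr j) = 0} → J₁ = K₁ ∧ J₂ = K₂ := by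
  have hσ := centered_sigma h.centered
  obtain ⟨θ, φ, hθ, hφ, hd, hφσ⟩ := exists_invariant hσ hT hres
  have hinj : Function.Injective (diff θ) := fun u u' hu => by
    rw [hd, hd] at hu
    exact funext fun j => congr_fun (T.symm.injective hu) (Sum.inl j)
  have hrange : ∀ v, v ∈ LinearMap.range (diff θ) ↔ ∀ j, T v (Sum.inr j) = 0 := by
    refine fun v => ⟨?_, fun hv => ⟨fun j => T v (Sum.inl j), ?_⟩⟩
    · rintro ⟨u, rfl⟩ j
      rw [hd, T.apply_symm_apply]
      rfl
    · rw [hd, LinearEquiv.symm_apply_eq]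
      funext c
      rcases c with j | j
      exacts [rfl, (hv j).symm]
  -- The restriction of `σ` to `H` is invertible, being a restriction of a product of involutions;
  -- invariance of the ideal thus becomes an equivalence.
  have hφinv : ∀ f : MvPowerSeries ι ℂ, comp φ f = 0 → f = 0 := by
    have hφd : Function.Injective (diff φ) := by
      refine (injective_iff_map_eq_zero _).2 fun u hu => ?_
      have h1 : diff (sigma τ) (diff θ u) = 0 := by
        rw [← diff_comp hθ, funext hφσ, diff_comp hφ, hu, map_zero]
      rw [diff_sigma h.centered] at h1
      have h2 := congrArg (diff τ) h1
      rw [h.diff_diff hq, map_zero] at h2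
      have h3 := congrArg conjVec h2
      rw [conjVec_conjVec, conjVec_zero] at h3
      have h4 := congrArg (diff τ) h3
      rw [h.diff_diff hq, map_zero] at h4
      have h5 := congrArg conjVec h4
      rw [conjVec_conjVec, conjVec_zero] at h5
      exact (injective_iff_map_eq_zero _).1 hinj u h5
    obtain ⟨χ, hχ, -, h2⟩ := exists_inverse hφ ⟨hφd, LinearMap.injective_iff_surjective.1 hφd⟩
    intro f hf
    have := congrArg (comp χ) hf
    rwa [comp_comp hφ hχ, funext h2, comp_id, comp_zero hχ] at this
  have hinv : ∀ f, f ∈ vanishingIdeal θ hθ ↔ comp (sigma τ) f ∈ vanishingIdeal θ hθ := fun f => by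
    rw [mem_vanishingIdeal, mem_vanishingIdeal, comp_comp hσ hθ, funext hφσ, ← comp_comp hθ hφ]
    exact ⟨fun hf => by rw [hf, comp_zero hφ], hφinv _⟩
  have hconj : ∀ f ∈ vanishingIdeal θ hθ, conjugate f ∈ vanishingIdeal θ hθ := by
    have hmem : ∀ f, f ∈ vanishingIdeal (conjParam θ) (centered_conjParam hθ) ↔
        conjugate f ∈ vanishingIdeal θ hθ := fun f => by
      rw [mem_vanishingIdeal, mem_vanishingIdeal, comp_conjParam_eq_zero_iff hθ]
    -- `ρH` has the tangent space of `H` and is `σ`-invariant as `ρσρ = σ⁻¹`; uniqueness gives `ρH =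
    -- H`.
    have key := invariant_unique hσ hT hres hθ (centered_conjParam hθ) hinj
      (fun u u' hu => by
        rw [diff_conjParam, diff_conjParam] at hu
        have h1 := congrArg conjVec hu
        rw [conjVec_conjVec, conjVec_conjVec] at h1
        exact funext fun a => (starRingEnd ℂ).injective (congr_fun (hinj h1) a))
      (fun v => (hrange _).1 ⟨v, rfl⟩)
      (fun v k => by
        rw [diff_conjParam]
        exact h.apply_conjVec_inr hq hν hT hs ((hrange _).1 ⟨_, rfl⟩) k)
      (fun f => (hinv f).1)
      (fun f hf => by
        rw [hmem] at hf ⊢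
        rw [comp_sigma h.centered, comp_rhoConj h.centered, conjugate_conjugate, hinv,
          comp_sigma h.centered, h.comp_comp_self hq]
        have e : conjugate (comp τ f) = comp (rhoConj τ) (conjugate f) := by
          rw [comp_rhoConj h.centered, conjugate_conjugate]
        rwa [e, h.comp_rhoConj_self hq])
    intro f hf
    rw [key, hmem] at hf
    exact hf
  have hdisj : ∀ v ∈ LinearMap.range (diff θ), diff τ v ∈ LinearMap.range (diff θ) → v = 0 := by
    intro v hv hv'
    rw [hrange] at hv hv'
    have h1 : diff τ v = 0 := T.injective (by
      rw [map_zero]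
      funext c
      rcases c with j | j
      exacts [h.apply_diff_inl hq hν hT hv j, hv' j])
    rw [← h.diff_diff hq v, h1, map_zero]
  have htan : ∀ {θ' : ι ⊕ ι → MvPowerSeries ι ℂ} (hθ' : Centered θ'),
      Function.Injective (diff θ') → (tangentSpace (vanishingIdeal θ' hθ') : Set (ι ⊕ ι → ℂ)) =
        LinearMap.range (diff θ') := fun hθ' hi => by rw [tangentSpace_vanishingIdeal hθ' hi]
  refine ⟨_, _, isAsymptoticPair hq h hθ hinj hconj (fun f => (hinv f).1) hdisj, ?_⟩
  have hθ₂ : Centered fun k => comp θ (τ k) := Centered.comp h.centered hθ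
  rw [complexification_vanishingIdeal hq.centered_sq hθ,
    complexification_vanishingIdeal hq.centered_sq hθ₂]
  refine ⟨isFormalSubmanifold_vanishingIdeal hθ hinj, hinv, ?_, fun f => ?_, ?_⟩
  · rw [htan hθ hinj]
    exact Set.ext hrange
  · rw [mem_vanishingIdeal, mem_vanishingIdeal, comp_comp h.centered hθ]
  · intro J₁ J₂ hJ hJT
    obtain ⟨θ', hθ', hinj', rfl, rfl, hinv'⟩ := hJ.exists_param hq h
    rw [complexification_vanishingIdeal hq.centered_sq hθ', htan hθ' hinj'] at hJT
    have key := invariant_unique hσ hT hres hθ' hθ hinj' hinj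
      (fun v => hJT.le ⟨v, rfl⟩) (fun v => (hrange _).1 ⟨v, rfl⟩) hinv' (fun f => (hinv f).1)
    have hiff : ∀ f, comp θ' f = 0 ↔ comp θ f = 0 := fun f => by
      rw [← mem_vanishingIdeal (hθ := hθ'), key, mem_vanishingIdeal]
    have hθ'₂ : Centered fun k => comp θ' (τ k) := Centered.comp h.centered hθ'
    constructor
    · ext f
      rw [mem_vanishingIdeal, mem_vanishingIdeal, comp_ambientParam hq.centered_sq hθ',
        comp_ambientParam hq.centered_sq hθ, hiff]
    · ext f
      rw [mem_vanishingIdeal, mem_vanishingIdeal, comp_ambientParam hq.centered_sq hθ'₂,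
        comp_ambientParam hq.centered_sq hθ₂, ← comp_comp h.centered hθ',
        ← comp_comp h.centered hθ, hiff]

end pairs

section

/-! ### The eigenvalues of `Dσ` -/

section eigenvalues

variable {ι : Type}

/-- The permutation of the coordinates `(ξ, η)` which exchanges `ξ_j` and `η_j` when
`ε_j = -1`. -/
def signPerm (ε : ι → ℤˣ) : Equiv.Perm (ι ⊕ ι) :=
  Function.Involutive.toPerm
    (Sum.elim (fun j => if ε j = 1 then Sum.inl j else Sum.inr j)
      (fun j => if ε j = 1 then Sum.inr j else Sum.inl j))
    (by rintro (j | j) <;> by_cases hj : ε j = 1 <;> simp [hj])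

theorem signPerm_inl (ε : ι → ℤˣ) (j : ι) :
    signPerm ε (Sum.inl j) = if ε j = 1 then Sum.inl j else Sum.inr j := rfl

theorem signPerm_inr (ε : ι → ℤˣ) (j : ι) :
    signPerm ε (Sum.inr j) = if ε j = 1 then Sum.inr j else Sum.inl j := rfl

/-- The lists `(ν, ν⁻¹)` and `(μ, μ⁻¹)` differ by the permutation `signPerm`, which reduces
arbitrary signs to the eigenspaces of the `ν_j`. -/
theorem elim_zpow_eq (μ : ι → ℂ) (ε : ι → ℤˣ) (c : ι ⊕ ι) :
    Sum.elim (fun j => μ j ^ ((ε j : ℤˣ) : ℤ)) (fun j => (μ j ^ ((ε j : ℤˣ) : ℤ))⁻¹) c =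
      Sum.elim μ (fun j => (μ j)⁻¹) (signPerm ε c) := by
  rcases c with j | j <;> rcases Int.units_eq_one_or (ε j) with h | h <;>
    simp [signPerm_inl, signPerm_inr, h]

theorem isDiagonalizedBy_signPerm [Fintype ι] {σ : ι ⊕ ι → MvPowerSeries (ι ⊕ ι) ℂ} {μ : ι → ℂ}
    {T : (ι ⊕ ι → ℂ) ≃ₗ[ℂ] (ι ⊕ ι → ℂ)} (hT : IsDiagonalIn (jacobian σ) μ T) (ε : ι → ℤˣ) :
    IsDiagonalizedBy σ (fun j => μ j ^ ((ε j : ℤˣ) : ℤ)) (fun j => (μ j ^ ((ε j : ℤˣ) : ℤ))⁻¹)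
      (T.trans (LinearEquiv.funCongrLeft ℂ ℂ (signPerm ε))) := by
  have h1 : ∀ v c, T (diff σ v) c = Sum.elim μ (fun j => (μ j)⁻¹) c * T v c := by
    rintro v (j | j)
    exacts [(hT v j).1, (hT v j).2]
  have h2 : ∀ v c, T (diff σ v) (signPerm ε c) =
      Sum.elim (fun j => μ j ^ ((ε j : ℤˣ) : ℤ)) (fun j => (μ j ^ ((ε j : ℤˣ) : ℤ))⁻¹) c *
        T v (signPerm ε c) := fun v c => by rw [h1, elim_zpow_eq]
  exact ⟨fun v j => h2 v (Sum.inl j), fun v j => h2 v (Sum.inr j)⟩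

theorem prescribedSpace_eq (T : (ι ⊕ ι → ℂ) ≃ₗ[ℂ] (ι ⊕ ι → ℂ)) (ε : ι → ℤˣ) :
    prescribedSpace T ε =
      {v | ∀ j, T.trans (LinearEquiv.funCongrLeft ℂ ℂ (signPerm ε)) v (Sum.inr j) = 0} := by
  ext v
  refine forall_congr' fun j => ?_
  change _ ↔ T v (signPerm ε (Sum.inr j)) = 0
  rw [signPerm_inr]
  rcases Int.units_eq_one_or (ε j) with h | h <;> simp [h]

end eigenvalues

/-! ### The hypotheses of the abstract theorem for perturbed quadrics. -/

variable {h s : ℕ} {γh : Fin h → ℝ} {γs : Fin s → ℂ}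

theorem partner_partner (j : Idx h s) : partner (partner j) = j := by
  rcases j with j | j | j <;> rfl

theorem gam_ne_zero (hγh : ∀ j, 1 / 2 < γh j) (hγs : ∀ j, (γs j).re < 1 / 2 ∧ 0 < (γs j).im)
    (j : Idx h s) : gam γh γs j ≠ 0 := by
  rcases j with j | j | j
  · have := hγh j
    exact Complex.ofReal_ne_zero.2 (by linarith)
  · intro h0
    have := congrArg Complex.im (show γs j = 0 from h0)
    exact (hγs j).2.ne' (by simpa using this)
  · intro h0
    have := congrArg Complex.im (show 1 - starRingEnd ℂ (γs j) = 0 from h0)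
    exact (hγs j).2.ne' (by simpa using this)

theorem hypLambda_mul_conj {γ : ℝ} (hγ : 1 / 2 < γ) :
    hypLambda γ * starRingEnd ℂ (hypLambda γ) = 1 := by
  have h1 : 1 / (2 * γ) < 1 := by rw [div_lt_one (by linarith)]; linarith
  have h0 : 0 < 1 / (2 * γ) := one_div_pos.2 (by linarith)
  have h2 : 0 ≤ 1 - (1 / (2 * γ)) ^ 2 := by nlinarith
  rw [Complex.mul_conj, hypLambda, Complex.normSq_mk, Real.mul_self_sqrt h2]
  norm_num
  ring

/-- In the hyperbolic case `|μ_h| = 1`; for complex pairs this is the definition of `μ_{s+s_*}`. -/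
theorem conj_mu_inv (hγh : ∀ j, 1 / 2 < γh j) (j : Idx h s) :
    (starRingEnd ℂ (mu γh γs j))⁻¹ = mu γh γs (partner j) := by
  rcases j with j | j | j
  · refine inv_eq_of_mul_eq_one_right ?_
    change starRingEnd ℂ (hypLambda (γh j) ^ 2) * hypLambda (γh j) ^ 2 = 1
    rw [map_pow, ← mul_pow, mul_comm, hypLambda_mul_conj (hγh j), one_pow]
  · rfl
  · simp [mu, partner]

theorem conj_nu_inv (hγh : ∀ j, 1 / 2 < γh j) (ε : Fin h ⊕ Fin s → ℤˣ) (j : Idx h s) :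
    (starRingEnd ℂ (nu γh γs ε j))⁻¹ = nu γh γs ε (partner j) := by
  have hsign : signs ε (partner j) = signs ε j := by rcases j with j | j | j <;> rfl
  rw [nu, nu, hsign, ← conj_mu_inv hγh, map_zpow₀, inv_zpow]

theorem isTransverse_definingRoot (hγh : ∀ j, 1 / 2 < γh j)
    (hγs : ∀ j, (γs j).re < 1 / 2 ∧ 0 < (γs j).im)
    {E : Idx h s → MvPowerSeries (Idx h s ⊕ Idx h s) ℂ} (hE : ∀ j, VanishesTo 2 (E j)) :
    IsTransverse fun j =>
      X (Sum.inl j) + (2 * gam γh γs j) • X (Sum.inr (partner j)) + E j := by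
  refine ⟨fun j => by simp [(vanishesTo_two_iff.1 (hE j)).1], ?_⟩
  have hinj : Function.Injective (diff (squareCoords fun j : Idx h s =>
      X (Sum.inl j) + (2 * gam γh γs j) • X (Sum.inr (partner j)) + E j)) := by
    refine (injective_iff_map_eq_zero _).2 fun v hv => ?_
    have hl : ∀ j, v (Sum.inl j) = 0 := fun j =>
      (diff_squareCoords_inl v j).symm.trans (congr_fun hv (Sum.inl j))
    funext c
    rcases c with j | j
    · exact hl j
    -- The variable `w_j` enters the linear forms only through `L` with index `partner j`, with the
    -- nonzero coefficient `2γ`.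
    · have h1 : ∑ k, linearPart (X (Sum.inl (partner j)) +
          (2 * gam γh γs (partner j)) • X (Sum.inr (partner (partner j))) +
            E (partner j)) k * v k = 0 := congr_fun hv (Sum.inr (partner j))
      rw [partner_partner] at h1
      simp only [linearPart_add, linearPart_smul, linearPart_X, linearPart_eq_zero (hE _),
        Pi.add_apply, Pi.smul_apply, smul_eq_mul, add_mul, Finset.sum_add_distrib,
        Pi.single_apply, ite_mul, mul_ite, mul_one, mul_zero, one_mul, zero_mul,
        Finset.sum_ite_eq', Finset.mem_univ, if_true, hl, zero_add] at h1
      simpa [gam_ne_zero hγh hγs] using h1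
  exact ⟨hinj, LinearMap.injective_iff_surjective.1 hinj⟩

end

end CRSing

end

/-! ### Conclusion. -/

theorem mainTheorem8 (h s : ℕ)
    (γh : Fin h → ℝ) (hγh : ∀ j, 1 / 2 < γh j)
    (γs : Fin s → ℂ) (hγs : ∀ j, (γs j).re < 1 / 2 ∧ 0 < (γs j).im)
    (E : CRSing.Idx h s → MvPowerSeries (CRSing.Idx h s ⊕ CRSing.Idx h s) ℂ)
    (hEconv : ∀ j, CRSing.IsConvergent (E j))
    (hEord : ∀ j n, n.degree < 2 → MvPowerSeries.coeff n (E j) = 0)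
    (hdist : Function.Injective
      (Sum.elim (CRSing.mu γh γs) (fun j => (CRSing.mu γh γs j)⁻¹)))
    (ε : Fin h ⊕ Fin s → ℤˣ)
    (hν : ∀ Q : CRSing.Idx h s → ℕ, 1 < ∑ k, Q k →
      ∀ j, ∏ k, CRSing.nu γh γs ε k ^ Q k ≠ (CRSing.nu γh γs ε j)⁻¹) :
    (∃! τ₁, CRSing.IsTauOne (CRSing.definingSeries γh γs E) τ₁) ∧
    ∀ τ₁, CRSing.IsTauOne (CRSing.definingSeries γh γs E) τ₁ →
      ∀ T, CRSing.IsDiagonalIn (CRSing.jacobian (CRSing.sigma τ₁)) (CRSing.mu γh γs) T →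
        ∃ K₁ K₂,
          CRSing.IsAsymptoticPair (CRSing.definingSeries γh γs E) K₁ K₂ ∧
          CRSing.IsFormalSubmanifold
            (CRSing.complexification (CRSing.definingSeries γh γs E) K₁) (h + 2 * s) ∧
          CRSing.IsImage (CRSing.sigma τ₁)
            (CRSing.complexification (CRSing.definingSeries γh γs E) K₁)
            (CRSing.complexification (CRSing.definingSeries γh γs E) K₁) ∧
          (CRSing.tangentSpace
            (CRSing.complexification (CRSing.definingSeries γh γs E) K₁) : Set _) =
              CRSing.prescribedSpace T (CRSing.signs ε) ∧
          CRSing.IsImage τ₁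
            (CRSing.complexification (CRSing.definingSeries γh γs E) K₁)
            (CRSing.complexification (CRSing.definingSeries γh γs E) K₂) ∧
          ∀ J₁ J₂, CRSing.IsAsymptoticPair (CRSing.definingSeries γh γs E) J₁ J₂ →
            (CRSing.tangentSpace
              (CRSing.complexification (CRSing.definingSeries γh γs E) J₁) : Set _) =
                CRSing.prescribedSpace T (CRSing.signs ε) →
            J₁ = K₁ ∧ J₂ = K₂ := by
  have hq := CRSing.isTransverse_definingRoot hγh hγs (E := E) hEord
  refine ⟨?_, fun τ₁ hτ T hT => ?_⟩
  · obtain ⟨τ, hτ⟩ := hq.exists_isReflection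
    exact ⟨τ, hτ.isTauOne hq, fun τ' hτ' =>
      (CRSing.IsTauOne.isReflection hq hτ').unique hq hτ⟩
  · have hr := CRSing.IsTauOne.isReflection hq hτ
    have hcard : Fintype.card (CRSing.Idx h s) = h + 2 * s := by
      simp only [CRSing.Idx, Fintype.card_sum, Fintype.card_fin]
      ring
    -- After `signPerm` the prescribed space is `{y = 0}`, the form required by
    -- `exists_unique_asymptoticPair`.
    rw [CRSing.prescribedSpace_eq, ← hcard]
    refine CRSing.exists_unique_asymptoticPair hq hr (ν := CRSing.nu γh γs ε) ?_
      (CRSing.isDiagonalizedBy_signPerm hT (CRSing.signs ε)) (CRSing.conj_nu_inv hγh ε) ?_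
    · have : (Sum.elim (CRSing.nu γh γs ε) fun j => (CRSing.nu γh γs ε j)⁻¹) =
          Sum.elim (CRSing.mu γh γs) (fun j => (CRSing.mu γh γs j)⁻¹) ∘
            CRSing.signPerm (CRSing.signs ε) :=
        funext (CRSing.elim_zpow_eq _ (CRSing.signs ε))
      rw [this]
      exact hdist.comp (Equiv.injective _)
    · intro k n hn
      rw [Finsupp.prod_fintype _ _ (by simp)]
      exact hν n (by rwa [← Finsupp.degree_eq_sum]) k
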